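/- Let $M$ be a smooth manifold without boundary (Hausdorff, second countable) of dimension $n$, equipped with a locally finite Borel measure $\mu$, and let $L^2(M)=L^2(M,\mu;\mathbb C)$. Let $\mathbf X=\{X_1,\dots,X_r\}$ be a Hörmander system on $M$, that is, a finite family of smooth real vector fields such that at every $x\in M$ the values at $x$ of the elements of the real Lie algebra of vector fields generated by $\mathbf X$ fill the tangent space $T_xM$. Let $\mathcal L=-\sum_{j=1}^r X_j^2$ be the associated sub-Laplacian. Assume that $\mathcal L$, defined on smooth functions, i.e. with domain $\{f\in C^\infty(M;\mathbb C): f\in L^2(M),\ \mathcal L f\in L^2(M)\}$, is a non-negative essentially self-adjoint operator on $L^2(M)$, and let $\overline{\mathcal L}=\int_{\mathbb R}\lambda\,dE_\lambda$ be the spectral decomposition of its self-adjoint closure, $E$ being its projection-valued spectral measure. (The assumption holds in particular if $\mathcal L$ is non-negative and essentially self-adjoint on $C_0^\infty(M)$.) Let $s>0$ and let $\phi:M\to\mathbb C$ be a smooth function. Then the following are equivalent: i. there exist $A,C>0$ such that $\mathcal L^k\phi\in L^2(M)$ and $\|\mathcal L^k\phi\|_{L^2}\le C A^{2k}\big((2k)!\big)^s$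 for every integer $k\ge 0$, where $\mathcal L^k\phi$ is obtained by applying the differential operator $\mathcal L$ to $\phi$ $k$ times; ii. there exists $D>0$ such that $\|e^{D\mathcal L^{1/(2s)}}\phi\|_{L^2}<\infty$, that is, $\phi\in L^2(M)$ and $\phi$ belongs to the domain of $e^{D\overline{\mathcal L}^{1/(2s)}}$: $\int_{\mathbb R} \big|e^{D\lambda^{1/(2s)}}\big|^2\,d\langle E_\lambda\phi,\phi\rangle<\infty$. -/

import Mathlib

open MeasureTheory
open scoped Manifold ContDiff

noncomputable section

/-! ### Spectral calculus of an unbounded self-adjoint operator -/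

section Spectral

variable {H : Type*} [NormedAddCommGroup H] [InnerProductSpace ℂ H] [CompleteSpace H]

/-- An operator on `H`, given by its graph `Γ`, is essentially self-adjoint: the closure of `Γ`
is the graph of a self-adjoint (single-valued, densely defined) operator. -/
def IsEssentiallySelfAdjoint (Γ : Submodule ℂ (H × H)) : Prop :=
  ∃ A : H →ₗ.[ℂ] H, IsSelfAdjoint A ∧ A.graph = Γ.topologicalClosure

/-- The operator `T` with graph `Γ` is non-negative: `⟨v, T v⟩` is real and non-negative for all
`v` in its domain. -/
def IsNonnegativeOperator (Γ : Submodule ℂ (H × H)) : Prop :=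
  ∀ p ∈ Γ, 0 ≤ (inner ℂ p.1 p.2).re ∧ (inner ℂ p.1 p.2).im = 0

/-- The closure of the operator with graph `Γ`.  If this operator is essentially self-adjoint,
its closure is its unique self-adjoint extension. -/
def operatorClosure (Γ : Submodule ℂ (H × H)) : H →ₗ.[ℂ] H :=
  Γ.topologicalClosure.toLinearPMap

theorem IsEssentiallySelfAdjoint.closure_spec {Γ : Submodule ℂ (H × H)}
    (h : IsEssentiallySelfAdjoint Γ) :
    IsSelfAdjoint (operatorClosure Γ) ∧ (operatorClosure Γ).graph = Γ.topologicalClosure := by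
  obtain ⟨A, hA, hgr⟩ := h
  have hg : (operatorClosure Γ).graph = Γ.topologicalClosure := by
    refine Submodule.toLinearPMap_graph_eq _ ?_
    intro x hx hx0
    rw [← hgr] at hx
    exact LinearPMap.graph_fst_eq_zero_snd A (x := x.1) (x' := x.2) hx hx0
  have : operatorClosure Γ = A := LinearPMap.eq_of_eq_graph (hg.trans hgr.symm)
  exact ⟨this ▸ hA, hg⟩

variable (H) in
/-- A projection-valued measure on the Borel sets of `ℝ`, with values in the orthogonal
projections of `H`. The values on non-measurable sets are irrelevant. -/
structure ProjectionValuedMeasure where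
  proj : Set ℝ → H →L[ℂ] H
  isStarProjection : ∀ S, MeasurableSet S → IsStarProjection (proj S)
  proj_empty : proj ∅ = 0
  proj_univ : proj Set.univ = 1
  proj_inter : ∀ S T, MeasurableSet S → MeasurableSet T → proj (S ∩ T) = proj S * proj T
  hasSum_proj : ∀ S : ℕ → Set ℝ, (∀ i, MeasurableSet (S i)) →
    Pairwise (Function.onFun Disjoint S) → ∀ v : H,
    HasSum (fun i => proj (S i) v) (proj (⋃ i, S i) v)

namespace ProjectionValuedMeasure

variable (E : ProjectionValuedMeasure H)

theorem re_inner_nonneg {S : Set ℝ} (hS : MeasurableSet S) (v : H) :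
    0 ≤ (inner ℂ v (E.proj S v)).re := by
  have h := E.isStarProjection S hS
  have h1 : E.proj S (E.proj S v) = E.proj S v := congrArg (· v) h.isIdempotentElem.eq
  have h2 : inner ℂ v (E.proj S (E.proj S v)) = inner ℂ (E.proj S v) (E.proj S v) := by
    have h3 := ContinuousLinearMap.adjoint_inner_left (E.proj S) (E.proj S v) v
    rwa [ContinuousLinearMap.isSelfAdjoint_iff'.mp h.isSelfAdjoint, eq_comm] at h3
  rw [← h1, h2]
  exact inner_self_nonneg (𝕜 := ℂ) (x := E.proj S v)

/-- The finite Borel measure `S ↦ ⟨v, E(S) v⟩` on `ℝ`. -/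
def scalarMeasure (v : H) : Measure ℝ :=
  Measure.ofMeasurable (fun S _ => ENNReal.ofReal (inner ℂ v (E.proj S v)).re)
    (by simp [E.proj_empty])
    (by
      intro S hS hd
      have h1 := (E.hasSum_proj S hS hd v).mapL (Complex.reCLM.comp
        ((innerSL ℂ v).restrictScalars ℝ))
      have h2 : HasSum (fun i => (inner ℂ v (E.proj (S i) v)).re)
          (inner ℂ v (E.proj (⋃ i, S i) v)).re := by simpa using h1
      rw [← h2.tsum_eq, ENNReal.ofReal_tsum_of_nonneg
        (fun i => E.re_inner_nonneg (hS i) v) h2.summable])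

/-- `A = ∫ λ dE(λ)`: the domain of `A` consists of the `v` with `∫ λ² d⟨v, E(λ) v⟩ < ∞`, and
`⟨v, A v⟩ = ∫ λ d⟨v, E(λ) v⟩` for these `v`. -/
def IsSpectralMeasureOf (A : H →ₗ.[ℂ] H) : Prop :=
  (∀ v : H, v ∈ A.domain ↔ ∫⁻ t, ENNReal.ofReal (t ^ 2) ∂(E.scalarMeasure v) < ⊤) ∧
  ∀ v : A.domain, inner ℂ (v : H) (A v) = ((∫ t, t ∂(E.scalarMeasure v) : ℝ) : ℂ)

end ProjectionValuedMeasure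

/-- The domain of `g(A) = ∫ g(λ) dE(λ)`, where `E` is the spectral measure of `A`: all `v` with
`∫ |g(λ)|² d⟨v, E(λ) v⟩ < ∞`.  This integral is `‖g(A) v‖²`. -/
def functionalCalculusDomain (A : H →ₗ.[ℂ] H) (g : ℝ → ℝ) : Set H :=
  {v | ∃ E : ProjectionValuedMeasure H, E.IsSpectralMeasureOf A ∧
    ∫⁻ t, ENNReal.ofReal (|g t| ^ 2) ∂(E.scalarMeasure v) < ⊤}

end Spectral

/-! ### Hörmander systems and sub-Laplacians -/

section SubLaplacian

variable {n : ℕ} {M : Type*} [TopologicalSpace M] [ChartedSpace (EuclideanSpace ℝ (Fin n)) M]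

/-- The real Lie algebra of vector fields generated by `X 0, …, X (r - 1)`. -/
inductive LieGenerated {r : ℕ} (X : Fin r → (x : M) → TangentSpace (𝓡 n) x) :
    ((x : M) → TangentSpace (𝓡 n) x) → Prop
  | base (j : Fin r) : LieGenerated X (X j)
  | zero : LieGenerated X 0
  | add {V W : (x : M) → TangentSpace (𝓡 n) x} :
      LieGenerated X V → LieGenerated X W → LieGenerated X (V + W)
  | smul (c : ℝ) {V : (x : M) → TangentSpace (𝓡 n) x} :
      LieGenerated X V → LieGenerated X (c • V)
  | bracket {V W : (x : M) → TangentSpace (𝓡 n) x} :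
      LieGenerated X V → LieGenerated X W →
      LieGenerated X (VectorField.mlieBracket (𝓡 n) V W)

/-- A Hörmander system on `M`: smooth real vector fields which generate a Lie algebra whose values
at every point `x` fill the tangent space at `x`. -/
structure IsHormanderSystem {r : ℕ} [IsManifold (𝓡 n) ∞ M]
    (X : Fin r → (x : M) → TangentSpace (𝓡 n) x) : Prop where
  smooth : ∀ j, ContMDiff (𝓡 n) (𝓡 n).tangent ∞
    (fun x => (⟨x, X j x⟩ : TangentBundle (𝓡 n) M))
  span : ∀ (x : M) (v : TangentSpace (𝓡 n) x), ∃ V, LieGenerated X V ∧ V x = v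

/-- The derivative `V f` of a complex-valued function `f` along a vector field `V`. -/
def applyField (V : (x : M) → TangentSpace (𝓡 n) x) (f : M → ℂ) : M → ℂ :=
  fun x => mfderiv (𝓡 n) 𝓘(ℝ, ℂ) f x (V x)

/-- The sub-Laplacian `L f = -∑ⱼ Xⱼ (Xⱼ f)`. -/
def subLaplacian {r : ℕ} (X : Fin r → (x : M) → TangentSpace (𝓡 n) x) (f : M → ℂ) : M → ℂ :=
  fun x => -∑ j, applyField (X j) (applyField (X j) f) x

theorem applyField_add {V : (x : M) → TangentSpace (𝓡 n) x} {f g : M → ℂ}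
    (hf : ContMDiff (𝓡 n) 𝓘(ℝ, ℂ) ∞ f) (hg : ContMDiff (𝓡 n) 𝓘(ℝ, ℂ) ∞ g) :
    applyField V (f + g) = applyField V f + applyField V g := by
  funext x
  have := mfderiv_add (hf.mdifferentiable (by simp) x) (hg.mdifferentiable (by simp) x)
  simp only [applyField, Pi.add_apply]
  rw [this]
  rfl

theorem applyField_smul {V : (x : M) → TangentSpace (𝓡 n) x} {f : M → ℂ} (c : ℂ)
    (hf : ContMDiff (𝓡 n) 𝓘(ℝ, ℂ) ∞ f) :
    applyField V (c • f) = c • applyField V f := by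
  funext x
  let l : ℂ →L[ℝ] ℂ := c • ContinuousLinearMap.id ℝ ℂ
  have h : HasMFDerivAt (𝓡 n) 𝓘(ℝ, ℂ) (l ∘ f) x _ :=
    (l.hasMFDerivAt (x := f x)).comp x (hf.mdifferentiable (by simp) x).hasMFDerivAt
  have h' : c • f = l ∘ f := by funext y; simp [l]
  simp only [applyField, Pi.smul_apply]
  rw [h', h.mfderiv]
  rfl

theorem contMDiff_applyField [IsManifold (𝓡 n) ∞ M] {V : (x : M) → TangentSpace (𝓡 n) x}
    (hV : ContMDiff (𝓡 n) (𝓡 n).tangent ∞ (fun x => (⟨x, V x⟩ : TangentBundle (𝓡 n) M)))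
    {f : M → ℂ} (hf : ContMDiff (𝓡 n) 𝓘(ℝ, ℂ) ∞ f) :
    ContMDiff (𝓡 n) 𝓘(ℝ, ℂ) ∞ (applyField V f) :=
  (contMDiff_snd_tangentBundle_modelSpace ℂ 𝓘(ℝ, ℂ)).comp
    ((hf.contMDiff_tangentMap (m := ∞) (by simp)).comp hV)

theorem subLaplacian_add [IsManifold (𝓡 n) ∞ M] {r : ℕ}
    {X : Fin r → (x : M) → TangentSpace (𝓡 n) x} (hX : IsHormanderSystem X) {f g : M → ℂ}
    (hf : ContMDiff (𝓡 n) 𝓘(ℝ, ℂ) ∞ f) (hg : ContMDiff (𝓡 n) 𝓘(ℝ, ℂ) ∞ g) :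
    subLaplacian X (f + g) = subLaplacian X f + subLaplacian X g := by
  funext x
  simp only [subLaplacian, Pi.add_apply, ← neg_add, ← Finset.sum_add_distrib]
  congr 1
  refine Finset.sum_congr rfl fun j _ => ?_
  rw [applyField_add hf hg, applyField_add (contMDiff_applyField (hX.smooth j) hf)
    (contMDiff_applyField (hX.smooth j) hg)]
  rfl

theorem subLaplacian_smul [IsManifold (𝓡 n) ∞ M] {r : ℕ}
    {X : Fin r → (x : M) → TangentSpace (𝓡 n) x} (hX : IsHormanderSystem X) {f : M → ℂ} (c : ℂ)
    (hf : ContMDiff (𝓡 n) 𝓘(ℝ, ℂ) ∞ f) :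
    subLaplacian X (c • f) = c • subLaplacian X f := by
  funext x
  simp only [subLaplacian, Pi.smul_apply, smul_neg, Finset.smul_sum]
  congr 1
  refine Finset.sum_congr rfl fun j _ => ?_
  rw [applyField_smul c hf, applyField_smul c (contMDiff_applyField (hX.smooth j) hf)]
  rfl

/-- The sub-Laplacian, defined on the smooth functions, as an operator on `L²(M, μ)`: the graph
consisting of the pairs `(f, L f)` with `f` smooth and both `f` and `L f` square-integrable. -/
def subLaplacianGraph [IsManifold (𝓡 n) ∞ M] [MeasurableSpace M] (μ : Measure M) {r : ℕ}
    {X : Fin r → (x : M) → TangentSpace (𝓡 n) x} (hX : IsHormanderSystem X) :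
    Submodule ℂ (Lp ℂ 2 μ × Lp ℂ 2 μ) where
  carrier := {p | ∃ f : M → ℂ, ContMDiff (𝓡 n) 𝓘(ℝ, ℂ) ∞ f ∧
    ∃ (hf : MemLp f 2 μ) (hLf : MemLp (subLaplacian X f) 2 μ), p = (hf.toLp f, hLf.toLp _)}
  zero_mem' := by
    have h0 : subLaplacian X (0 : M → ℂ) = 0 := by
      simpa using subLaplacian_smul hX (f := (0 : M → ℂ)) 0 contMDiff_const
    exact ⟨0, contMDiff_const, MemLp.zero, by rw [h0]; exact MemLp.zero, by
      simp only [h0]; rfl⟩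
  add_mem' := by
    rintro _ _ ⟨f, hf, hf2, hLf, rfl⟩ ⟨g, hg, hg2, hLg, rfl⟩
    have h := subLaplacian_add hX hf hg
    exact ⟨f + g, hf.add hg, hf2.add hg2, h ▸ hLf.add hLg, by
      simp only [h]; rfl⟩
  smul_mem' := by
    rintro c _ ⟨f, hf, hf2, hLf, rfl⟩
    have h := subLaplacian_smul hX c hf
    refine ⟨c • f, ?_, hf2.const_smul c, h ▸ hLf.const_smul c, by
      simp only [h]; rfl⟩
    exact (c • ContinuousLinearMap.id ℝ ℂ).contMDiff.comp hf

end SubLaplacian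

end

/-! ### L² functional calculi -/

/-! Let `A` be the self-adjoint closure of the sub-Laplacian and write μ_v for the measure ⟨v, E v⟩.
Since ∫ λ^(2k) dμ_φ = ‖A^k φ‖² (`lintegral_pow`), and μ_φ lives on [0, ∞), the claim compares the
even moments of μ_φ with its exponential moment ∫ exp(2D λ^(1/(2s))) dμ_φ. In one direction, y^m ≤
m! e^y bounds λ^m by (m!)^(2s) times the exponential, up to a geometric factor
(`pow_le_mul_exp_sq`). In the other, the exponential is bounded at each λ by a single term w_k
λ^(2k) with k depending on λ, hence by the sum over all k, whose integral is at most a geometric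
series (`exists_exp_le_mul_pow`).

Membership in the domain asks for some spectral measure, so i ⇒ ii needs the spectral theorem. The
resolvent R = (1 + A)⁻¹ is bounded and self-adjoint; its continuous calculus, with Riesz measures,
extends by L² density to indicators, and the resulting projections are carried to ℝ by t ↦ 1/t - 1.
`L2Calculus` isolates this extension step, so that it also applies to simple functions of a given
`E`, where it shows that `A` is multiplication by λ. Both estimates hold for any spectral measure of
`A`, so its uniqueness plays no role.

For ii ⇒ i the abstract iterates A^k φ must be the functions obtained by differentiating φ. This is
`ae_eq_subLaplacian_of_mem_graph`: symmetry of `A` against test functions shows that A f is the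
pointwise sub-Laplacian of a smooth f. -/

section L2Calculus

open Filter Topology
open scoped ENNReal

/-- A calculus of bounded operators `op f` with bounded real symbols `sym f`, the symbols being
dense in every space `L²(ν)` with `ν` finite, and with `⟨v, op f v⟩ = ∫ sym f d(meas v)`. -/
structure L2Calculus (H : Type*) [NormedAddCommGroup H] [InnerProductSpace ℂ H] [CompleteSpace H]
    (α : Type*) [MeasurableSpace α] (V : Type*) [Ring V] [Algebra ℝ V] where
  sym : V →ₐ[ℝ] (α → ℝ)
  op : V →ₐ[ℝ] (H →L[ℂ] H)
  meas : H → Measure α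
  isFiniteMeasure_meas : ∀ v, IsFiniteMeasure (meas v)
  measurable_sym : ∀ f, Measurable (sym f)
  exists_bound_sym : ∀ f, ∃ c : ℝ, ∀ x, |sym f x| ≤ c
  inner_op : ∀ f v, inner ℂ v (op f v) = ((∫ x, sym f x ∂(meas v) : ℝ) : ℂ)
  exists_approx : ∀ (ν : Measure α) [IsFiniteMeasure ν] (g : α → ℝ), MemLp g 2 ν →
    ∀ ε : ℝ≥0∞, ε ≠ 0 → ∃ f, eLpNorm (g - sym f) 2 ν ≤ ε

namespace L2Calculus

variable {H : Type*} [NormedAddCommGroup H] [InnerProductSpace ℂ H] [CompleteSpace H]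
  {α : Type*} [MeasurableSpace α] {V : Type*} [Ring V] [Algebra ℝ V] (C : L2Calculus H α V)

instance (v : H) : IsFiniteMeasure (C.meas v) := C.isFiniteMeasure_meas v

theorem memLp_sym (f : V) (ν : Measure α) [IsFiniteMeasure ν] : MemLp (C.sym f) 2 ν := by
  obtain ⟨c, hc⟩ := C.exists_bound_sym f
  exact MemLp.of_bound (C.measurable_sym f).aestronglyMeasurable c (ae_of_all _ hc)

/-- On a complex space a real quadratic form forces symmetry, by polarization. -/
theorem inner_op_left (f : V) (v w : H) : inner ℂ (C.op f v) w = inner ℂ v (C.op f w) := by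
  have h : (C.op f : H →ₗ[ℂ] H).IsSymmetric := by
    rw [LinearMap.isSymmetric_iff_inner_map_self_real]
    intro v
    have := C.inner_op f v
    simp only [ContinuousLinearMap.coe_coe]
    rw [← inner_conj_symm (𝕜 := ℂ) (C.op f v) v, this]
    simp
  exact h v w

theorem sq_norm_op (f : V) (v : H) : ‖C.op f v‖ ^ 2 = ∫ x, (C.sym f x) ^ 2 ∂(C.meas v) := by
  have h1 := C.inner_op (f * f) v
  rw [map_mul, mul_apply_eq_comp, ← C.inner_op_left,
    inner_self_eq_norm_sq_to_K] at h1
  have h2 : ((‖C.op f v‖ ^ 2 : ℝ) : ℂ) = ((∫ x, C.sym (f * f) x ∂(C.meas v) : ℝ) : ℂ) := by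
    rw [← h1]; push_cast; rfl
  rw [Complex.ofReal_injective h2]
  simp [pow_two]

theorem _root_.MeasureTheory.MemLp.eLpNorm_two_sq {ν : Measure α} {g : α → ℝ}
    (hg : MemLp g 2 ν) : eLpNorm g 2 ν ^ 2 = ENNReal.ofReal (∫ x, g x ^ 2 ∂ν) := by
  rw [ofReal_integral_eq_lintegral_ofReal hg.integrable_sq (ae_of_all _ fun x => sq_nonneg _)]
  have := eLpNorm_nnreal_pow_eq_lintegral (μ := ν) (f := g) (p := 2) (by simp)
  simp only [NNReal.coe_ofNat, ENNReal.rpow_ofNat, ENNReal.coe_ofNat] at this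
  rw [this]
  refine lintegral_congr fun x => ?_
  rw [Real.enorm_eq_ofReal_abs, ← ENNReal.ofReal_pow (abs_nonneg _), sq_abs]

theorem enorm_op (f : V) (v : H) : ‖C.op f v‖ₑ = eLpNorm (C.sym f) 2 (C.meas v) := by
  have h := (C.memLp_sym f (C.meas v)).eLpNorm_two_sq
  rw [← C.sq_norm_op, ENNReal.ofReal_pow (norm_nonneg _), ofReal_norm] at h
  exact (ENNReal.pow_right_strictMono two_ne_zero).injective h.symm

/-- `w = g(T) v`, in terms of the isometry from `L²(meas v)` to `H` sending `sym f` to `op f v`. -/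
structure IsValue (v : H) (g : α → ℝ) (w : H) : Prop where
  memLp : MemLp g 2 (C.meas v)
  enorm_sub : ∀ f, ‖w - C.op f v‖ₑ = eLpNorm (g - C.sym f) 2 (C.meas v)

theorem exists_seq (ν : Measure α) [IsFiniteMeasure ν] {g : α → ℝ} (hg : MemLp g 2 ν) :
    ∃ f : ℕ → V, Tendsto (fun k => eLpNorm (g - C.sym (f k)) 2 ν) atTop (𝓝 0) := by
  have h : ∀ k : ℕ, ∃ f, eLpNorm (g - C.sym f) 2 ν ≤ ((k : ℝ≥0∞) + 1)⁻¹ := fun k =>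
    C.exists_approx ν g hg _ (by simp)
  choose f hf using h
  refine ⟨f, tendsto_of_tendsto_of_tendsto_of_le_of_le tendsto_const_nhds ?_
    (fun _ => zero_le) hf⟩
  have := (tendsto_add_atTop_iff_nat 1).2 ENNReal.tendsto_inv_nat_nhds_zero
  simpa using this

variable {C}

theorem IsValue.tendsto {v w : H} {g : α → ℝ} (h : C.IsValue v g w) {f : ℕ → V}
    (hf : Tendsto (fun k => eLpNorm (g - C.sym (f k)) 2 (C.meas v)) atTop (𝓝 0)) :
    Tendsto (fun k => C.op (f k) v) atTop (𝓝 w) := by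
  rw [tendsto_iff_edist_tendsto_0]
  simpa only [edist_comm, edist_eq_enorm_sub w, h.enorm_sub] using hf

/-- The distances to all the vectors `op f' v` pass to the limit, so a single approximating sequence
decides the value. -/
theorem IsValue.of_tendsto {v w : H} {g : α → ℝ} (hg : MemLp g 2 (C.meas v)) {f : ℕ → V}
    (hf : Tendsto (fun k => eLpNorm (g - C.sym (f k)) 2 (C.meas v)) atTop (𝓝 0))
    (hw : Tendsto (fun k => C.op (f k) v) atTop (𝓝 w)) : C.IsValue v g w := by
  refine ⟨hg, fun f' => ?_⟩
  have h1 : Tendsto (fun k => ‖C.op (f k) v - C.op f' v‖ₑ) atTop (𝓝 ‖w - C.op f' v‖ₑ) :=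
    (hw.sub_const _).enorm
  refine tendsto_nhds_unique h1 ?_
  have h2 : ∀ k, ‖C.op (f k) v - C.op f' v‖ₑ =
      eLpNorm (C.sym (f k) - C.sym f') 2 (C.meas v) := fun k => by
    rw [← map_sub, ← C.enorm_op, map_sub]; rfl
  simp only [h2]
  have hm := fun f => (C.memLp_sym f (C.meas v)).aestronglyMeasurable
  set b := eLpNorm (g - C.sym f') 2 (C.meas v)
  have hl : ∀ k, b - eLpNorm (g - C.sym (f k)) 2 (C.meas v) ≤
      eLpNorm (C.sym (f k) - C.sym f') 2 (C.meas v) := fun k => by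
    rw [tsub_le_iff_left]
    have := eLpNorm_add_le (hg.aestronglyMeasurable.sub (hm (f k))) ((hm (f k)).sub (hm f'))
      (p := 2) (by norm_num)
    simpa [b] using this
  have hu : ∀ k, eLpNorm (C.sym (f k) - C.sym f') 2 (C.meas v) ≤
      b + eLpNorm (g - C.sym (f k)) 2 (C.meas v) := fun k => by
    have := eLpNorm_sub_le (hg.aestronglyMeasurable.sub (hm f'))
      (hg.aestronglyMeasurable.sub (hm (f k))) (p := 2) (by norm_num)
    simpa [b] using this
  -- Truncated subtraction in `ℝ≥0∞` is continuous here only because `b` is finite.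
  have hb : b ≠ ⊤ := (hg.sub (C.memLp_sym f' _)).eLpNorm_ne_top
  refine tendsto_of_tendsto_of_tendsto_of_le_of_le ?_ ?_ hl hu
  · simpa using ENNReal.Tendsto.sub (tendsto_const_nhds (x := b)) hf (Or.inl hb)
  · simpa using (tendsto_const_nhds (x := b)).add hf

-- The map from symbols to vectors is isometric, so an L²-approximation of `g` yields a Cauchy
-- sequence in `H`.
variable (C) in
theorem exists_isValue (v : H) {g : α → ℝ} (hg : MemLp g 2 (C.meas v)) :
    ∃ w, C.IsValue v g w := by
  obtain ⟨f, hf⟩ := C.exists_seq (C.meas v) hg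
  have hc : CauchySeq fun k => C.op (f k) v := by
    rw [EMetric.cauchySeq_iff]
    intro ε hε
    have h2 : ∀ᶠ k in atTop, eLpNorm (g - C.sym (f k)) 2 (C.meas v) < ε / 2 :=
      hf.eventually_lt_const (ENNReal.half_pos hε.ne')
    obtain ⟨N, hN⟩ := eventually_atTop.1 h2
    refine ⟨N, fun k hk l hl => ?_⟩
    have h3 : edist (C.op (f k) v) (C.op (f l) v) =
        eLpNorm ((g - C.sym (f l)) - (g - C.sym (f k))) 2 (C.meas v) := by
      rw [edist_eq_enorm_sub, sub_sub_sub_cancel_left, ← map_sub, ← C.enorm_op, map_sub]; rfl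
    rw [h3]
    have hm := fun f => hg.aestronglyMeasurable.sub
      (C.memLp_sym f (C.meas v)).aestronglyMeasurable
    calc _ ≤ _ := eLpNorm_sub_le (hm _) (hm _) (by norm_num)
      _ < ε / 2 + ε / 2 := ENNReal.add_lt_add (hN l hl) (hN k hk)
      _ = ε := ENNReal.add_halves ε
  obtain ⟨w, hw⟩ := cauchySeq_tendsto_of_complete hc
  exact ⟨w, .of_tendsto hg hf hw⟩

theorem IsValue.unique {v w w' : H} {g : α → ℝ} (h : C.IsValue v g w) (h' : C.IsValue v g w') :
    w = w' := by
  obtain ⟨f, hf⟩ := C.exists_seq (C.meas v) h.memLp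
  exact tendsto_nhds_unique (h.tendsto hf) (h'.tendsto hf)

theorem IsValue.congr {v w : H} {g g' : α → ℝ} (h : C.IsValue v g w)
    (hg : g =ᵐ[C.meas v] g') : C.IsValue v g' w :=
  ⟨(memLp_congr_ae hg).1 h.memLp, fun f => by
    rw [h.enorm_sub, eLpNorm_congr_ae (hg.sub (ae_eq_refl _))]⟩

theorem IsValue.enorm {v w : H} {g : α → ℝ} (h : C.IsValue v g w) :
    ‖w‖ₑ = eLpNorm g 2 (C.meas v) := by
  simpa using h.enorm_sub 0

variable (C) in
theorem isValue_op (f : V) (v : H) : C.IsValue v (C.sym f) (C.op f v) :=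
  ⟨C.memLp_sym f _, fun f' => by rw [← map_sub, ← C.enorm_op, map_sub]; rfl⟩

variable (C) in
theorem isValue_one (v : H) : C.IsValue v 1 v := by
  simpa using C.isValue_op 1 v

variable (C) in
theorem isValue_zero (v : H) : C.IsValue v 0 0 := by
  simpa using C.isValue_op 0 v

theorem IsValue.add {v w w' : H} {g g' : α → ℝ} (h : C.IsValue v g w)
    (h' : C.IsValue v g' w') : C.IsValue v (g + g') (w + w') := by
  obtain ⟨f, hf⟩ := C.exists_seq (C.meas v) h.memLp
  obtain ⟨f', hf'⟩ := C.exists_seq (C.meas v) h'.memLp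
  refine .of_tendsto (f := fun k => f k + f' k) (h.memLp.add h'.memLp) ?_ ?_
  · refine tendsto_of_tendsto_of_tendsto_of_le_of_le tendsto_const_nhds
      (by simpa using hf.add hf') (fun _ => zero_le) fun k => ?_
    rw [map_add, add_sub_add_comm]
    exact eLpNorm_add_le (h.memLp.sub (C.memLp_sym _ _)).aestronglyMeasurable
      (h'.memLp.sub (C.memLp_sym _ _)).aestronglyMeasurable (by norm_num)
  · simpa using (h.tendsto hf).add (h'.tendsto hf')

theorem IsValue.op_mul {v w : H} {g : α → ℝ} (h : C.IsValue v g w) (p : V) :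
    C.IsValue v (C.sym p * g) (C.op p w) := by
  obtain ⟨f, hf⟩ := C.exists_seq (C.meas v) h.memLp
  obtain ⟨c, hc⟩ := C.exists_bound_sym p
  have hle : ∀ g : α → ℝ, eLpNorm (C.sym p * g) 2 (C.meas v) ≤
      ENNReal.ofReal c * eLpNorm g 2 (C.meas v) := fun g =>
    eLpNorm_le_mul_eLpNorm_of_ae_le_mul (ae_of_all _ fun x => by
      simpa [abs_mul] using mul_le_mul_of_nonneg_right (hc x) (abs_nonneg (g x))) _
  refine .of_tendsto (f := fun k => p * f k) ⟨(C.measurable_sym p).aestronglyMeasurable.mul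
    h.memLp.aestronglyMeasurable, (hle g).trans_lt
      (ENNReal.mul_lt_top ENNReal.ofReal_lt_top h.memLp.eLpNorm_lt_top)⟩ ?_ ?_
  · refine tendsto_of_tendsto_of_tendsto_of_le_of_le tendsto_const_nhds
      (by simpa using ENNReal.Tendsto.const_mul (a := ENNReal.ofReal c) hf
            (Or.inr ENNReal.ofReal_ne_top)) (fun _ => zero_le) fun k => ?_
    rw [map_mul, ← mul_sub]
    exact hle _
  · simpa [Function.comp_def] using ((C.op p).continuous.tendsto w).comp (h.tendsto hf)

-- Density in L² of the sum ν₁ + ν₂ + ν₃ approximates in all three at once. The same operators then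
-- act on different vectors, which is what makes g(T) linear and symmetric in the vector.
variable (C) in
theorem exists_common_seq (ν₁ ν₂ ν₃ : Measure α) [IsFiniteMeasure ν₁] [IsFiniteMeasure ν₂]
    [IsFiniteMeasure ν₃] {g : α → ℝ} (h₁ : MemLp g 2 ν₁) (h₂ : MemLp g 2 ν₂)
    (h₃ : MemLp g 2 ν₃) : ∃ f : ℕ → V,
      Tendsto (fun k => eLpNorm (g - C.sym (f k)) 2 ν₁) atTop (𝓝 0) ∧
      Tendsto (fun k => eLpNorm (g - C.sym (f k)) 2 ν₂) atTop (𝓝 0) ∧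
      Tendsto (fun k => eLpNorm (g - C.sym (f k)) 2 ν₃) atTop (𝓝 0) := by
  have hm := (h₁.aestronglyMeasurable.add_measure h₂.aestronglyMeasurable).add_measure
    h₃.aestronglyMeasurable
  have hg : MemLp g 2 (ν₁ + ν₂ + ν₃) := by
    rw [memLp_two_iff_integrable_sq hm]
    exact (h₁.integrable_sq.add_measure h₂.integrable_sq).add_measure h₃.integrable_sq
  obtain ⟨f, hf⟩ := C.exists_seq _ hg
  have key : ∀ ν ≤ ν₁ + ν₂ + ν₃, Tendsto (fun k => eLpNorm (g - C.sym (f k)) 2 ν) atTop (𝓝 0) :=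
    fun ν hν => tendsto_of_tendsto_of_tendsto_of_le_of_le tendsto_const_nhds hf
      (fun _ => zero_le) fun k => eLpNorm_mono_measure _ hν
  refine ⟨f, key _ ?_, key _ ?_, key _ ?_⟩
  · exact (Measure.le_add_right le_rfl).trans (Measure.le_add_right le_rfl)
  · exact (Measure.le_add_left le_rfl).trans (Measure.le_add_right le_rfl)
  · exact Measure.le_add_left le_rfl

theorem IsValue.add_vector {v v' w w' : H} {g : α → ℝ} (h : C.IsValue v g w)
    (h' : C.IsValue v' g w') (hg : MemLp g 2 (C.meas (v + v'))) :
    C.IsValue (v + v') g (w + w') := by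
  obtain ⟨f, h1, h2, h3⟩ := C.exists_common_seq _ _ _ h.memLp h'.memLp hg
  exact .of_tendsto hg h3 (by simpa using (h.tendsto h1).add (h'.tendsto h2))

theorem IsValue.smul_vector {v w : H} {g : α → ℝ} (h : C.IsValue v g w) (c : ℂ)
    (hg : MemLp g 2 (C.meas (c • v))) : C.IsValue (c • v) g (c • w) := by
  obtain ⟨f, h1, h2, -⟩ := C.exists_common_seq _ _ _ h.memLp hg hg
  exact .of_tendsto hg h2 (by simpa using (h.tendsto h1).const_smul c)

theorem IsValue.inner_comm {v v' w w' : H} {g : α → ℝ} (h : C.IsValue v g w)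
    (h' : C.IsValue v' g w') : inner ℂ w v' = inner ℂ v w' := by
  obtain ⟨f, h1, h2, -⟩ := C.exists_common_seq _ _ _ h.memLp h'.memLp h'.memLp
  have h3 : Tendsto (fun k => inner ℂ (C.op (f k) v) v') atTop (𝓝 (inner ℂ w v')) :=
    (h.tendsto h1).inner tendsto_const_nhds
  have h4 : Tendsto (fun k => inner ℂ v (C.op (f k) v')) atTop (𝓝 (inner ℂ v w')) :=
    tendsto_const_nhds.inner (h'.tendsto h2)
  simp only [C.inner_op_left] at h3
  exact tendsto_nhds_unique h3 h4

theorem IsValue.inner_eq {v w : H} {g : α → ℝ} (h : C.IsValue v g w) :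
    inner ℂ v w = ((∫ x, g x ∂(C.meas v) : ℝ) : ℂ) := by
  obtain ⟨f, hf⟩ := C.exists_seq _ h.memLp
  have h1 : Tendsto (fun k => inner ℂ v (C.op (f k) v)) atTop (𝓝 (inner ℂ v w)) :=
    tendsto_const_nhds.inner (h.tendsto hf)
  simp only [C.inner_op] at h1
  refine tendsto_nhds_unique h1 ((Complex.continuous_ofReal.tendsto _).comp ?_)
  refine tendsto_integral_of_L1' g (h.memLp.integrable (by norm_num)).aestronglyMeasurable
    (.of_forall fun k => (C.memLp_sym _ _).integrable (by norm_num)) ?_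
  -- On a finite measure L² convergence implies L¹ convergence, at the cost of a power of the total
  -- mass.
  have h2 := ENNReal.Tendsto.mul_const hf
    (b := C.meas v Set.univ ^ (1 / (1 : ℝ≥0∞).toReal - 1 / (2 : ℝ≥0∞).toReal))
    (Or.inr (ENNReal.rpow_ne_top_of_nonneg (by norm_num) (measure_ne_top _ _)))
  rw [zero_mul] at h2
  refine tendsto_of_tendsto_of_tendsto_of_le_of_le tendsto_const_nhds h2
    (fun _ => zero_le) fun k => ?_
  rw [eLpNorm_sub_comm]
  exact eLpNorm_le_eLpNorm_mul_rpow_measure_univ (by norm_num)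
    (h.memLp.sub (C.memLp_sym _ _)).aestronglyMeasurable

end L2Calculus
end L2Calculus

section SpectralCalculus

open Filter Topology
open scoped ENNReal

namespace L2Calculus

variable {H : Type*} [NormedAddCommGroup H] [InnerProductSpace ℂ H] [CompleteSpace H]
  {α : Type*} [MeasurableSpace α] {V : Type*} [Ring V] [Algebra ℝ V] {C : L2Calculus H α V}

theorem IsValue.neg {v w : H} {g : α → ℝ} (h : C.IsValue v g w) : C.IsValue v (-g) (-w) := by
  simpa using h.op_mul (-1)

theorem IsValue.sub {v w w' : H} {g g' : α → ℝ} (h : C.IsValue v g w)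
    (h' : C.IsValue v g' w') : C.IsValue v (g - g') (w - w') := by
  simpa [sub_eq_add_neg] using h.add h'.neg

theorem memLp_indicator_one (ν : Measure α) [IsFiniteMeasure ν] {S : Set α}
    (hS : MeasurableSet S) : MemLp (S.indicator (1 : α → ℝ)) 2 ν :=
  memLp_indicator_const 2 hS 1 (Or.inr (measure_ne_top _ _))

theorem eLpNorm_indicator_one_le (ν : Measure α) (S : Set α) :
    eLpNorm (S.indicator (1 : α → ℝ)) 2 ν ≤ eLpNorm (1 : α → ℝ) 2 ν :=
  eLpNorm_indicator_le _

variable (C)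

open Classical in
/-- The value of the calculus at the indicator function of a measurable set. -/
noncomputable def proj (S : Set α) : H →L[ℂ] H :=
  if hS : MeasurableSet S then
    have h v := C.exists_isValue v (memLp_indicator_one (C.meas v) hS)
    -- Uniqueness of values makes the chosen vectors linear in `v`; the bound 1 comes from the
    -- isometry and 1_S ≤ 1.
    LinearMap.mkContinuous
      { toFun := fun v => (h v).choose
        map_add' := fun v v' => (h (v + v')).choose_spec.unique
          ((h v).choose_spec.add_vector (h v').choose_spec (memLp_indicator_one _ hS))
        map_smul' := fun c v => (h (c • v)).choose_spec.unique
          ((h v).choose_spec.smul_vector c (memLp_indicator_one _ hS)) } 1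
      (fun v => by
        have h1 : ‖(h v).choose‖ₑ ≤ ‖v‖ₑ := by
          rw [(h v).choose_spec.enorm, (C.isValue_one v).enorm]
          exact eLpNorm_indicator_one_le _ _
        simpa using enorm_le_iff_norm_le.1 h1)
  else 0

theorem isValue_proj {S : Set α} (hS : MeasurableSet S) (v : H) :
    C.IsValue v (S.indicator 1) (C.proj S v) := by
  rw [proj, dif_pos hS]
  exact (C.exists_isValue v (memLp_indicator_one (C.meas v) hS)).choose_spec

theorem inner_proj {S : Set α} (hS : MeasurableSet S) (v : H) :
    inner ℂ v (C.proj S v) = (((C.meas v).real S : ℝ) : ℂ) := by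
  rw [(C.isValue_proj hS v).inner_eq, integral_indicator_one hS]

theorem inner_proj_left {S : Set α} (hS : MeasurableSet S) (v w : H) :
    inner ℂ (C.proj S v) w = inner ℂ v (C.proj S w) :=
  (C.isValue_proj hS v).inner_comm (C.isValue_proj hS w)

theorem _root_.MeasureTheory.eLpNorm_two_sq_eq_lintegral (ν : Measure α) (g : α → ℝ) :
    eLpNorm g 2 ν ^ 2 = ∫⁻ x, ‖g x‖ₑ ^ 2 ∂ν := by
  have := eLpNorm_nnreal_pow_eq_lintegral (μ := ν) (f := g) (p := 2) (by simp)
  simpa using this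

theorem _root_.MeasureTheory.eLpNorm_two_withDensity (ν : Measure α) {g h : α → ℝ}
    (hg : Measurable g) (hh : Measurable h) :
    eLpNorm h 2 (ν.withDensity fun x => ‖g x‖ₑ ^ 2) = eLpNorm (h * g) 2 ν := by
  refine (ENNReal.pow_right_strictMono two_ne_zero).injective ?_
  rw [eLpNorm_two_sq_eq_lintegral, eLpNorm_two_sq_eq_lintegral,
    lintegral_withDensity_eq_lintegral_mul _ (hg.enorm.pow_const 2) (hh.enorm.pow_const 2)]
  refine lintegral_congr fun x => ?_
  simp only [Pi.mul_apply, enorm_mul, mul_pow, mul_comm]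

theorem IsValue.isFiniteMeasure_withDensity {C : L2Calculus H α V} {v w : H} {g : α → ℝ}
    (h : C.IsValue v g w) : IsFiniteMeasure ((C.meas v).withDensity fun x => ‖g x‖ₑ ^ 2) := by
  refine MeasureTheory.isFiniteMeasure_withDensity ?_
  rw [← eLpNorm_two_sq_eq_lintegral]
  exact ENNReal.pow_ne_top h.memLp.eLpNorm_ne_top

/-- The symbols are taken to approximate 1_S both in L²(g² dμ_v) and in L²(μ_w): the operators
applied to `w` = g(T) v then converge to (1_S g)(T) v and to the projection of `w`. That the two
measures coincide is not known yet; it is deduced from this in `IsValue.meas_eq`. -/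
theorem IsValue.proj_mul {C : L2Calculus H α V} {v w : H} {g : α → ℝ}
    (h : C.IsValue v g w) (hg : Measurable g) {S : Set α} (hS : MeasurableSet S) :
    C.IsValue v (S.indicator g) (C.proj S w) := by
  have := h.isFiniteMeasure_withDensity
  obtain ⟨f, h1, h2, -⟩ := C.exists_common_seq ((C.meas v).withDensity fun x => ‖g x‖ₑ ^ 2)
    (C.meas w) (C.meas w)
    (memLp_indicator_one _ hS) (memLp_indicator_one _ hS) (memLp_indicator_one _ hS)
  obtain ⟨z, hz⟩ := C.exists_isValue v (h.memLp.indicator hS)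
  suffices z = C.proj S w from this ▸ hz
  refine tendsto_nhds_unique ?_ ((C.isValue_proj hS w).tendsto h2)
  rw [tendsto_iff_edist_tendsto_0]
  refine h1.congr fun k => ?_
  rw [edist_comm, edist_eq_enorm_sub, (hz.sub (h.op_mul (f k))).enorm,
    eLpNorm_two_withDensity _ hg ((measurable_one.indicator hS).sub (C.measurable_sym _))]
  congr 1
  ext x
  by_cases hx : x ∈ S <;> simp [hx, sub_mul]

/-- The measure of `g(T) v` has density `g²` with respect to the measure of `v`. -/
theorem IsValue.meas_eq {C : L2Calculus H α V} {v w : H} {g : α → ℝ} (h : C.IsValue v g w)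
    (hg : Measurable g) : C.meas w = (C.meas v).withDensity fun x => ‖g x‖ₑ ^ 2 := by
  ext S hS
  have h1 : ‖C.proj S w‖ₑ ^ 2 = C.meas w S := by
    rw [(C.isValue_proj hS w).enorm, eLpNorm_two_sq_eq_lintegral, ← lintegral_indicator_one hS]
    refine lintegral_congr fun x => ?_
    by_cases hx : x ∈ S <;> simp [hx]
  rw [← h1, (h.proj_mul hg hS).enorm, eLpNorm_two_sq_eq_lintegral, withDensity_apply _ hS,
    ← lintegral_indicator hS]
  refine lintegral_congr fun x => ?_
  by_cases hx : x ∈ S <;> simp [hx]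

theorem proj_inter {S T : Set α} (hS : MeasurableSet S) (hT : MeasurableSet T) :
    C.proj (S ∩ T) = C.proj S * C.proj T := by
  ext v
  have h := (C.isValue_proj hT v).proj_mul (measurable_one.indicator hT) hS
  rw [Set.indicator_indicator] at h
  exact (C.isValue_proj (hS.inter hT) v).unique h

theorem proj_union {S T : Set α} (hS : MeasurableSet S) (hT : MeasurableSet T)
    (hd : Disjoint S T) : C.proj (S ∪ T) = C.proj S + C.proj T := by
  ext v
  have h := (C.isValue_proj hS v).add (C.isValue_proj hT v)
  have h2 := Set.indicator_union_of_disjoint hd (1 : α → ℝ)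
  refine (C.isValue_proj (hS.union hT) v).unique ?_
  rw [h2]; exact h

theorem proj_empty : C.proj ∅ = 0 := by
  ext v
  refine (C.isValue_proj .empty v).unique ?_
  rw [Set.indicator_empty]
  exact C.isValue_zero v

theorem proj_univ : C.proj Set.univ = 1 := by
  ext v
  refine (C.isValue_proj .univ v).unique ?_
  rw [Set.indicator_univ]
  exact C.isValue_one v

theorem isStarProjection_proj {S : Set α} (hS : MeasurableSet S) :
    IsStarProjection (C.proj S) := by
  refine ⟨?_, ?_⟩
  · rw [IsIdempotentElem, ← C.proj_inter hS hS, Set.inter_self]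
  · rw [ContinuousLinearMap.isSelfAdjoint_iff_isSymmetric]
    exact C.inner_proj_left hS

theorem sq_norm_proj {S : Set α} (hS : MeasurableSet S) (v : H) :
    ‖C.proj S v‖ ^ 2 = (C.meas v).real S := by
  have h := C.inner_proj hS v
  have h2 : C.proj S (C.proj S v) = C.proj S v := by
    rw [← mul_apply_eq_comp, ← C.proj_inter hS hS, Set.inter_self]
  rw [← h2, ← C.inner_proj_left hS, inner_self_eq_norm_sq_to_K] at h
  exact Complex.ofReal_injective (by push_cast; exact h)

/-- The remainder of a partial sum is the projection onto the leftover set, and its squared norm is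
the measure of that set, which tends to 0 by countable additivity. -/
theorem hasSum_proj (S : ℕ → Set α) (hS : ∀ i, MeasurableSet (S i))
    (hd : Pairwise (Function.onFun Disjoint S)) (v : H) :
    HasSum (fun i => C.proj (S i) v) (C.proj (⋃ i, S i) v) := by
  have hA : ∀ s : Finset ℕ, MeasurableSet (⋃ i ∈ s, S i) := fun s =>
    s.measurableSet_biUnion fun i _ => hS i
  have hU : MeasurableSet (⋃ i, S i) := .iUnion hS
  have hsum : ∀ s : Finset ℕ, C.proj (⋃ i ∈ s, S i) v = ∑ i ∈ s, C.proj (S i) v := by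
    intro s
    induction s using Finset.induction_on with
    | empty => simp [C.proj_empty]
    | insert a s ha ih =>
      rw [Finset.set_biUnion_insert, C.proj_union (hS a) (hA s), Finset.sum_insert ha, ← ih]
      · rfl
      · simp only [Set.disjoint_iUnion_right]
        exact fun i hi => hd fun h => ha (h ▸ hi)
  have hdiff : ∀ s : Finset ℕ, C.proj (⋃ i, S i) v - ∑ i ∈ s, C.proj (S i) v =
      C.proj ((⋃ i, S i) \ ⋃ i ∈ s, S i) v := by
    intro s
    have hsub : (⋃ i ∈ s, S i) ⊆ ⋃ i, S i := Set.iUnion₂_subset_iUnion _ _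
    have := C.proj_union (hA s) (hU.diff (hA s)) Set.disjoint_sdiff_right
    rw [Set.union_sdiff_cancel hsub] at this
    rw [← hsum, this]
    simp
  have hm : HasSum (fun i => (C.meas v).real (S i)) ((C.meas v).real (⋃ i, S i)) := by
    have h : ∑' i, C.meas v (S i) ≠ ⊤ := by
      rw [← measure_iUnion hd hS]; exact measure_ne_top _ _
    rw [measureReal_def, measure_iUnion hd hS,
      ENNReal.tsum_toReal_eq fun i => measure_ne_top _ _]
    exact ENNReal.hasSum_toReal h
  have hsq : ∀ s : Finset ℕ, ‖∑ i ∈ s, C.proj (S i) v - C.proj (⋃ i, S i) v‖ ^ 2 =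
      (C.meas v).real (⋃ i, S i) - ∑ i ∈ s, (C.meas v).real (S i) := by
    intro s
    rw [norm_sub_rev, hdiff, C.sq_norm_proj (hU.diff (hA s)),
      measureReal_sdiff (Set.iUnion₂_subset_iUnion _ _) (hA s),
      measureReal_biUnion_finset (fun i _ j _ h => hd h) fun i _ => hS i]
  rw [HasSum, SummationFilter.unconditional_filter, tendsto_iff_norm_sub_tendsto_zero]
  have h0 : Tendsto (fun s : Finset ℕ => ‖∑ i ∈ s, C.proj (S i) v - C.proj (⋃ i, S i) v‖ ^ 2)
      atTop (𝓝 0) := by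
    simp only [hsq]
    have : Tendsto (fun s : Finset ℕ => ∑ i ∈ s, (C.meas v).real (S i)) atTop
      (𝓝 ((C.meas v).real (⋃ i, S i))) := hm
    simpa using this.const_sub ((C.meas v).real (⋃ i, S i))
  have := h0.sqrt
  simpa [Real.sqrt_sq] using this

/-- The projection-valued measure of a calculus, transported to `ℝ` by a measurable function. -/
noncomputable def projectionValuedMeasure {b : α → ℝ} (hb : Measurable b) :
    ProjectionValuedMeasure H where
  proj S := C.proj (b ⁻¹' S)
  isStarProjection S hS := C.isStarProjection_proj (hb hS)
  proj_empty := by simp [C.proj_empty]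
  proj_univ := by simp [C.proj_univ]
  proj_inter S T hS hT := C.proj_inter (hb hS) (hb hT)
  hasSum_proj S hS hd v := by
    rw [Set.preimage_iUnion]
    exact C.hasSum_proj _ (fun i => hb (hS i)) (fun i j h => (hd h).preimage b) v

theorem _root_.ProjectionValuedMeasure.scalarMeasure_apply (E : ProjectionValuedMeasure H) (v : H)
    {S : Set ℝ} (hS : MeasurableSet S) :
    E.scalarMeasure v S = ENNReal.ofReal (inner ℂ v (E.proj S v)).re :=
  Measure.ofMeasurable_apply S hS

theorem scalarMeasure_projectionValuedMeasure {b : α → ℝ} (hb : Measurable b) (v : H) :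
    (C.projectionValuedMeasure hb).scalarMeasure v = (C.meas v).map b := by
  ext S hS
  rw [ProjectionValuedMeasure.scalarMeasure_apply _ _ hS, Measure.map_apply hb hS]
  change ENNReal.ofReal (inner ℂ v (C.proj (b ⁻¹' S) v)).re = _
  rw [C.inner_proj (hb hS)]
  simp

end L2Calculus

/-! ### The calculus of a projection-valued measure -/

/-- The measurable sets, as a monoid under intersection. -/
def MeasurableSetMonoid (α : Type*) [MeasurableSpace α] := {S : Set α // MeasurableSet S}

instance (α : Type*) [MeasurableSpace α] : Monoid (MeasurableSetMonoid α) where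
  mul S T := ⟨S.1 ∩ T.1, S.2.inter T.2⟩
  one := ⟨Set.univ, .univ⟩
  mul_assoc S T U := Subtype.ext (Set.inter_assoc _ _ _)
  one_mul S := Subtype.ext (Set.univ_inter _)
  mul_one S := Subtype.ext (Set.inter_univ _)

/-- `S ↦ 1_S`, as a multiplicative map. -/
noncomputable def MeasurableSetMonoid.indicatorHom (α : Type*) [MeasurableSpace α] :
    MeasurableSetMonoid α →* (α → ℝ) where
  toFun S := S.1.indicator 1
  map_one' := Set.indicator_univ _
  map_mul' _ _ := Set.inter_indicator_one

/-- The algebra of symbols `∑ c_S 1_S`. -/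
noncomputable def symbolHom (α : Type*) [MeasurableSpace α] :
    MonoidAlgebra ℝ (MeasurableSetMonoid α) →ₐ[ℝ] (α → ℝ) :=
  MonoidAlgebra.lift ℝ _ _ (MeasurableSetMonoid.indicatorHom α)

theorem symbolHom_single {α : Type*} [MeasurableSpace α] (S : MeasurableSetMonoid α) (c : ℝ) :
    symbolHom α (MonoidAlgebra.single S c) = c • S.1.indicator (1 : α → ℝ) := by
  simp [symbolHom, MeasurableSetMonoid.indicatorHom]

theorem measurable_symbolHom {α : Type*} [MeasurableSpace α]
    (f : MonoidAlgebra ℝ (MeasurableSetMonoid α)) : Measurable (symbolHom α f) := by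
  induction f using MonoidAlgebra.induction_linear with
  | zero => rw [map_zero]; exact measurable_zero
  | add f g hf hg => rw [map_add]; exact hf.add hg
  | single S c =>
    rw [symbolHom_single]; exact (measurable_one.indicator S.2).const_smul c

theorem exists_bound_symbolHom {α : Type*} [MeasurableSpace α]
    (f : MonoidAlgebra ℝ (MeasurableSetMonoid α)) : ∃ c : ℝ, ∀ x, |symbolHom α f x| ≤ c := by
  induction f using MonoidAlgebra.induction_linear with
  | zero => exact ⟨0, by simp⟩
  | add f g hf hg =>
    obtain ⟨c, hc⟩ := hf
    obtain ⟨d, hd⟩ := hg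
    refine ⟨c + d, fun x => ?_⟩
    rw [map_add]
    exact (abs_add_le _ _).trans (add_le_add (hc x) (hd x))
  | single S c =>
    refine ⟨|c|, fun x => ?_⟩
    rw [symbolHom_single]
    by_cases hx : x ∈ S.1 <;> simp [hx]

/-- Simple functions are dense in L², so this supplies the approximation axiom. A simple function
has many representations as a formal sum; since operators are attached to formal sums, independence
of the representation is never needed. -/
theorem exists_symbolHom_eq {α : Type*} [MeasurableSpace α] (g : SimpleFunc α ℝ) :
    ∃ f, symbolHom α f = g := by
  induction g using SimpleFunc.induction with
  | const c hs =>
    let S : MeasurableSetMonoid α := ⟨_, hs⟩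
    refine ⟨MonoidAlgebra.single S c, ?_⟩
    rw [symbolHom_single]
    ext x
    simp [S, SimpleFunc.coe_piecewise, Set.indicator, Set.piecewise]
  | add _ hf hg =>
    obtain ⟨f, hf⟩ := hf
    obtain ⟨g, hg⟩ := hg
    exact ⟨f + g, by rw [map_add, hf, hg]; rfl⟩

namespace ProjectionValuedMeasure

variable {H : Type*} [NormedAddCommGroup H] [InnerProductSpace ℂ H] [CompleteSpace H]
  (E : ProjectionValuedMeasure H)

instance (v : H) : IsFiniteMeasure (E.scalarMeasure v) :=
  ⟨by rw [E.scalarMeasure_apply v .univ]; exact ENNReal.ofReal_lt_top⟩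

/-- `∑ c_S 1_S ↦ ∑ c_S E(S)`. -/
noncomputable def opHom : MonoidAlgebra ℝ (MeasurableSetMonoid ℝ) →ₐ[ℝ] (H →L[ℂ] H) :=
  MonoidAlgebra.lift ℝ _ _
    { toFun := fun S : MeasurableSetMonoid ℝ => E.proj S.1
      map_one' := E.proj_univ
      map_mul' := fun S T => E.proj_inter _ _ S.2 T.2 }

theorem opHom_single (S : MeasurableSetMonoid ℝ) (c : ℝ) :
    E.opHom (MonoidAlgebra.single S c) = c • E.proj S.1 := by
  simp [opHom]

theorem inner_proj {S : Set ℝ} (hS : MeasurableSet S) (v : H) :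
    inner ℂ v (E.proj S v) = (((E.scalarMeasure v).real S : ℝ) : ℂ) := by
  have h := E.isStarProjection S hS
  have h1 : (inner ℂ v (E.proj S v)).im = 0 := by
    have h2 := ((ContinuousLinearMap.isSelfAdjoint_iff_isSymmetric).1 h.isSelfAdjoint)
    exact h2.im_inner_self_apply v
  rw [measureReal_def, E.scalarMeasure_apply v hS, ENNReal.toReal_ofReal (E.re_inner_nonneg hS v)]
  exact Complex.ext rfl (by simpa using h1)

/-- The calculus of a projection-valued measure. -/
noncomputable def calculus : L2Calculus H ℝ (MonoidAlgebra ℝ (MeasurableSetMonoid ℝ)) where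
  sym := symbolHom ℝ
  op := E.opHom
  meas := E.scalarMeasure
  isFiniteMeasure_meas := inferInstance
  measurable_sym := measurable_symbolHom
  exists_bound_sym := exists_bound_symbolHom
  inner_op f v := by
    induction f using MonoidAlgebra.induction_linear with
    | zero => simp
    | add f g hf hg =>
      have hi : ∀ f, Integrable (symbolHom ℝ f) (E.scalarMeasure v) := fun f => by
        obtain ⟨c, hc⟩ := exists_bound_symbolHom f
        exact .of_bound (measurable_symbolHom f).aestronglyMeasurable c (ae_of_all _ hc)
      rw [map_add, map_add, add_apply, inner_add_right, hf, hg,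
        integral_add' (hi f) (hi g)]
      push_cast
      rfl
    | single S c =>
      rw [opHom_single, symbolHom_single]
      simp only [smul_apply, Pi.smul_apply, smul_eq_mul]
      rw [integral_const_mul, integral_indicator_one S.2, inner_smul_right_eq_smul,
        E.inner_proj S.2]
      simp
  exists_approx ν _ g hg ε hε := by
    obtain ⟨f, hf, -⟩ := hg.exists_simpleFunc_eLpNorm_sub_lt (by norm_num) hε
    obtain ⟨p, hp⟩ := exists_symbolHom_eq f
    exact ⟨p, hp ▸ hf.le⟩

end ProjectionValuedMeasure

/-! ### The calculus of a bounded self-adjoint operator -/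

section Bounded

variable {H : Type*} [NormedAddCommGroup H] [InnerProductSpace ℂ H] [CompleteSpace H]
  {R : H →L[ℂ] H} (hR : IsSelfAdjoint R)

/-- `f ↦ ⟨v, f(R) v⟩` -/
noncomputable def cfcFunctional (v : H) :
    CompactlySupportedContinuousMap (spectrum ℝ R) ℝ →ₚ[ℝ] ℝ :=
  PositiveLinearMap.mk₀
    { toFun := fun f => (inner ℂ v (cfcHom (R := ℝ) hR f v)).re
      map_add' := fun f g => by
        have : ((f + g : CompactlySupportedContinuousMap (spectrum ℝ R) ℝ) :
          C(spectrum ℝ R, ℝ)) = f + g := rfl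
        rw [this, map_add]
        simp
      map_smul' := fun c f => by
        have : ((c • f : CompactlySupportedContinuousMap (spectrum ℝ R) ℝ) :
          C(spectrum ℝ R, ℝ)) = c • (f : C(spectrum ℝ R, ℝ)) := rfl
        rw [this, map_smul, smul_apply, inner_smul_right_eq_smul]
        simp }
    (fun f hf => by
      -- Positivity: with g = √f, ⟨v, f(R) v⟩ = ‖g(R) v‖².
      let g : C(spectrum ℝ R, ℝ) := ⟨fun x => √(f x), by fun_prop⟩
      have hg : (f : C(spectrum ℝ R, ℝ)) = g * g := by
        ext x; exact (Real.mul_self_sqrt (hf x)).symm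
      have hs : IsSelfAdjoint (cfcHom (R := ℝ) hR g) := isSelfAdjoint_map (cfcHom hR) g
      have hsym := ContinuousLinearMap.isSelfAdjoint_iff_isSymmetric.1 hs
      change 0 ≤ (inner ℂ v (cfcHom (R := ℝ) hR f v)).re
      rw [hg, map_mul, mul_apply_eq_comp]
      have := hsym v (cfcHom (R := ℝ) hR g v)
      simp only [ContinuousLinearMap.coe_coe] at this
      rw [← this]
      exact inner_self_nonneg (𝕜 := ℂ))

/-- The continuous functional calculus of a bounded self-adjoint operator. -/
noncomputable def cfcCalculus : L2Calculus H (spectrum ℝ R) C(spectrum ℝ R, ℝ) where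
  sym := ContinuousMap.coeFnAlgHom ℝ
  op := (cfcHom (R := ℝ) hR).toAlgHom
  meas v := RealRMK.rieszMeasure (cfcFunctional hR v)
  isFiniteMeasure_meas v := inferInstance
  measurable_sym f := f.continuous.measurable
  exists_bound_sym f := ⟨‖f‖, fun x => f.norm_coe_le_norm x⟩
  inner_op f v := by
    -- The spectrum is compact, so every continuous function on it is compactly supported.
    have h := RealRMK.integral_rieszMeasure (cfcFunctional hR v)
      (CompactlySupportedContinuousMap.continuousMapEquiv f)
    have hs : IsSelfAdjoint (cfcHom (R := ℝ) hR f) := isSelfAdjoint_map (cfcHom hR) f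
    have h1 := (ContinuousLinearMap.isSelfAdjoint_iff_isSymmetric.1 hs).im_inner_self_apply v
    refine Complex.ext ?_ ?_
    · exact h.symm
    · exact h1
  exists_approx ν _ g hg ε hε := by
    obtain ⟨f, hf, -⟩ := hg.exists_boundedContinuous_eLpNorm_sub_le (by norm_num) hε
    exact ⟨f.toContinuousMap, hf⟩

end Bounded
end SpectralCalculus

/-! ### The resolvent and the spectral theorem for non-negative self-adjoint operators. -/

section SpectralTheorem

open Filter Topology
open scoped ENNReal

variable {H : Type*} [NormedAddCommGroup H] [InnerProductSpace ℂ H] {A : H →ₗ.[ℂ] H}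

/-- From ‖x‖² ≤ Re⟨x, (A + 1)x⟩ and Cauchy–Schwarz. It makes `1 + A` injective with closed range and
bounds its inverse by 1. -/
theorem norm_le_norm_apply_add (hpos : ∀ x : A.domain, 0 ≤ (inner ℂ (x : H) (A x)).re)
    (x : A.domain) : ‖(x : H)‖ ≤ ‖A x + x‖ := by
  have h1 : ‖(x : H)‖ ^ 2 ≤ (inner ℂ (x : H) (A x + x)).re := by
    have h2 : (inner ℂ (x : H) (x : H)).re = ‖(x : H)‖ ^ 2 := inner_self_eq_norm_sq (𝕜 := ℂ) _
    rw [inner_add_right, Complex.add_re, h2]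
    linarith [hpos x]
  have h2 : (inner ℂ (x : H) (A x + x)).re ≤ ‖(x : H)‖ * ‖A x + x‖ :=
    re_inner_le_norm (𝕜 := ℂ) _ _
  by_contra! h3
  have h4 : 0 < ‖(x : H)‖ := (norm_nonneg _).trans_lt h3
  nlinarith

/-- `1 + A` as a linear map on the domain of `A`. -/
def onePlus (A : H →ₗ.[ℂ] H) : A.domain →ₗ[ℂ] H := A.toFun + A.domain.subtype

theorem onePlus_apply (x : A.domain) : onePlus A x = A x + x := rfl

variable [CompleteSpace H]

theorem IsSelfAdjoint.inner_linearPMap (hA : IsSelfAdjoint A) (x y : A.domain) :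
    inner ℂ (A x) (y : H) = inner ℂ (x : H) (A y) := by
  have h := LinearPMap.adjoint_isFormalAdjoint hA.dense_domain
  rw [LinearPMap.isSelfAdjoint_def.1 hA] at h
  exact h x y

/-- The range is closed because `A` is closed and `1 + A` is bounded below. A vector u orthogonal to
it lies in the domain of A* = A; testing against u itself gives ⟨u, Au⟩ + ‖u‖² = 0, so u = 0. -/
theorem IsSelfAdjoint.onePlus_surjective (hA : IsSelfAdjoint A)
    (hpos : ∀ x : A.domain, 0 ≤ (inner ℂ (x : H) (A x)).re) :
    Function.Surjective (onePlus A) := by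
  have hclosed : IsClosed ((onePlus A).range : Set H) := by
    refine IsSeqClosed.isClosed fun y z hx hy => ?_
    choose x hx using hx
    have hc : CauchySeq fun n => (x n : H) := by
      refine Metric.cauchySeq_iff.2 fun ε hε => ?_
      obtain ⟨N, hN⟩ := Metric.cauchySeq_iff.1 hy.cauchySeq ε hε
      refine ⟨N, fun m hm n hn => lt_of_le_of_lt ?_ (hN m hm n hn)⟩
      have := norm_le_norm_apply_add hpos (x m - x n)
      rwa [← onePlus_apply, map_sub, hx, hx, ← dist_eq_norm, Submodule.coe_sub,
        ← dist_eq_norm] at this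
    obtain ⟨u, hu⟩ := cauchySeq_tendsto_of_complete hc
    have hg : (u, z - u) ∈ A.graph := by
      refine hA.isClosed.mem_of_tendsto (hu.prodMk_nhds (hy.sub hu)) (.of_forall fun n => ?_)
      rw [← hx n, onePlus_apply, add_sub_cancel_right]
      exact A.mem_graph (x n)
    obtain ⟨u', hu1, hu2⟩ := (LinearPMap.mem_graph_iff A).1 hg
    exact ⟨u', by rw [onePlus_apply, hu2]; simp [hu1]⟩
  have horth : (onePlus A).rangeᗮ = ⊥ := by
    rw [Submodule.eq_bot_iff]
    intro u hu
    rw [Submodule.mem_orthogonal'] at hu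
    have hu' : ∀ x : A.domain, inner ℂ u (A x + x) = 0 := fun x => hu _ ⟨x, rfl⟩
    have hdom : u ∈ A.domain := by
      rw [← LinearPMap.isSelfAdjoint_def.1 hA]
      refine LinearPMap.mem_adjoint_domain_of_exists u ⟨-u, fun x => ?_⟩
      have := hu' x
      rw [inner_add_right] at this
      rw [inner_neg_left, neg_eq_iff_add_eq_zero, add_comm]
      exact this
    have h1 := hu' ⟨u, hdom⟩
    rw [inner_add_right] at h1
    have h2 := congrArg Complex.re h1
    have h3 : (inner ℂ u u).re = ‖u‖ ^ 2 := inner_self_eq_norm_sq (𝕜 := ℂ) _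
    rw [Complex.add_re, h3, Complex.zero_re] at h2
    have h4 : ‖u‖ ^ 2 ≤ 0 := by linarith [hpos ⟨u, hdom⟩]
    simpa using le_antisymm h4 (sq_nonneg _)
  have : CompleteSpace (onePlus A).range := hclosed.completeSpace_coe
  exact LinearMap.range_eq_top.1 (Submodule.orthogonal_eq_bot_iff.1 horth)

/-- The resolvent `R = (1 + A)⁻¹` of a non-negative self-adjoint operator. -/
theorem IsSelfAdjoint.exists_resolvent (hA : IsSelfAdjoint A)
    (hpos : ∀ x : A.domain, 0 ≤ (inner ℂ (x : H) (A x)).re) :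
    ∃ R : H →L[ℂ] H, IsSelfAdjoint R ∧ Function.Injective R ∧ (∀ w, R w ∈ A.domain) ∧
      ∀ x : A.domain, R (A x + x) = x := by
  have hinj : Function.Injective (onePlus A) := by
    rw [injective_iff_map_eq_zero]
    intro x hx
    have := norm_le_norm_apply_add hpos x
    rw [← onePlus_apply, hx, norm_zero] at this
    simpa using this
  let e := LinearEquiv.ofBijective (onePlus A) ⟨hinj, hA.onePlus_surjective hpos⟩
  let R : H →L[ℂ] H := (A.domain.subtype ∘ₗ e.symm.toLinearMap).mkContinuous 1 fun w => by
    have := norm_le_norm_apply_add hpos (e.symm w)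
    rw [← onePlus_apply] at this
    have h2 : onePlus A (e.symm w) = w := e.apply_symm_apply w
    rw [h2] at this
    simpa using this
  have hR : ∀ x : A.domain, R (A x + x) = x := fun x =>
    congrArg Subtype.val (e.symm_apply_apply x)
  have hs : ∀ w, ∃ x : A.domain, A x + x = w := hA.onePlus_surjective hpos
  refine ⟨R, ?_, ?_, fun w => (e.symm w).2, hR⟩
  · rw [ContinuousLinearMap.isSelfAdjoint_iff_isSymmetric]
    intro w w'
    obtain ⟨x, rfl⟩ := hs w
    obtain ⟨y, rfl⟩ := hs w'
    simp only [ContinuousLinearMap.coe_coe, hR]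
    rw [inner_add_right, inner_add_left, hA.inner_linearPMap]
  · exact Subtype.val_injective.comp e.symm.injective

theorem enorm_sq_eq_ofReal (t : ℝ) : ‖t‖ₑ ^ 2 = ENNReal.ofReal (t ^ 2) := by
  rw [Real.enorm_eq_ofReal_abs, ← ENNReal.ofReal_pow (abs_nonneg _), sq_abs]

theorem memLp_two_iff_lintegral {α : Type*} [MeasurableSpace α] (ν : Measure α) {g : α → ℝ}
    (hg : Measurable g) : MemLp g 2 ν ↔ ∫⁻ x, ENNReal.ofReal (g x ^ 2) ∂ν < ⊤ := by
  have h := eLpNorm_two_sq_eq_lintegral ν g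
  simp only [enorm_sq_eq_ofReal] at h
  rw [← h, ENNReal.pow_lt_top_iff, MemLp]
  simp [hg.aestronglyMeasurable]

/-- The spectral theorem for non-negative self-adjoint operators. -/
theorem IsSelfAdjoint.exists_isSpectralMeasureOf (hA : IsSelfAdjoint A)
    (hpos : ∀ x : A.domain, 0 ≤ (inner ℂ (x : H) (A x)).re) :
    ∃ E : ProjectionValuedMeasure H, E.IsSpectralMeasureOf A := by
  obtain ⟨R, hR, hinj, hdom, hRA⟩ := hA.exists_resolvent hpos
  let C := cfcCalculus hR
  let ι : C(spectrum ℝ R, ℝ) := ⟨Subtype.val, continuous_subtype_val⟩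
  have hop : C.op ι = R := cfcHom_id hR
  have hsym : C.sym ι = Subtype.val := rfl
  let inv : spectrum ℝ R → ℝ := fun t => (t : ℝ)⁻¹
  have hinv : Measurable inv := measurable_subtype_coe.inv
  -- A point t = 1/(1 + λ) of the spectrum of `R` corresponds to λ = 1/t - 1.
  let b : spectrum ℝ R → ℝ := inv - 1
  have hb : Measurable b := hinv.sub measurable_const
  let Z : Set (spectrum ℝ R) := Subtype.val ⁻¹' {0}
  -- Since t · 1_{t = 0} = 0, `R` kills the projection onto `Z`, which vanishes by injectivity.
  have hzero : ∀ v, C.meas v Z = 0 := by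
    intro v
    have hS : MeasurableSet Z :=
      measurable_subtype_coe (measurableSet_singleton 0)
    have h1 := (C.isValue_proj hS v).op_mul ι
    have h2 : C.sym ι * Set.indicator Z 1 = 0 := by
      ext t
      by_cases ht : (t : ℝ) = 0 <;> simp [Z, hsym, ht]
    rw [h2, hop] at h1
    have h3 : C.proj Z v = 0 :=
      hinj (by rw [h1.unique (C.isValue_zero v), map_zero])
    have h4 := C.sq_norm_proj hS v
    rw [h3, norm_zero, zero_pow two_ne_zero] at h4
    exact (measureReal_eq_zero_iff).1 h4.symm
  -- If 1/t is square-integrable, u = (1/t)(R) v satisfies R u = v, which puts v in the domain of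
  -- `A`.
  have hval : ∀ v, MemLp b 2 (C.meas v) → ∃ u, C.IsValue v inv u ∧ R u = v := by
    intro v hv
    have h1 : MemLp inv 2 (C.meas v) := by
      have := hv.add (C.isValue_one v).memLp
      simpa [b] using this
    obtain ⟨u, hu⟩ := C.exists_isValue v h1
    refine ⟨u, hu, ?_⟩
    have h2 := hu.op_mul ι
    rw [hop] at h2
    refine h2.unique ((C.isValue_one v).congr ?_)
    have : ∀ᵐ t : spectrum ℝ R ∂(C.meas v), (t : ℝ) ≠ 0 := by
      rw [ae_iff]; simpa [Z, Set.preimage] using hzero v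
    filter_upwards [this] with t ht
    simp [hsym, inv, ht]
  -- As x = R(Ax + x), its measure has density t² with respect to that of Ax + x, and t · b = 1 - t
  -- is bounded. At t = 0 the convention 0⁻¹ = 0 makes the left side 0.
  have hmem : ∀ x : A.domain, MemLp b 2 (C.meas x) := by
    intro x
    have h1 : (x : H) = C.op ι (A x + x) := by rw [hop, hRA]
    have h2 := (C.isValue_op ι (A x + x)).meas_eq (C.measurable_sym ι)
    rw [← h1] at h2
    refine ⟨hb.aestronglyMeasurable, ?_⟩
    rw [h2, eLpNorm_two_withDensity _ (C.measurable_sym ι) hb]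
    refine lt_of_le_of_lt (eLpNorm_mono fun t => ?_)
      (C.memLp_sym (1 - ι) (C.meas (A x + x))).eLpNorm_lt_top
    by_cases ht : (t : ℝ) = 0
    · simp [hsym, ht]
    · simp [hsym, b, inv, ht, sub_mul]
  refine ⟨C.projectionValuedMeasure hb, fun v => ?_, fun v => ?_⟩
  · rw [C.scalarMeasure_projectionValuedMeasure hb, lintegral_map (by fun_prop) hb,
      ← memLp_two_iff_lintegral _ hb]
    refine ⟨fun hv => hmem ⟨v, hv⟩, fun hv => ?_⟩
    obtain ⟨u, -, hu⟩ := hval v hv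
    exact hu ▸ hdom u
  · rw [C.scalarMeasure_projectionValuedMeasure hb,
      integral_map hb.aemeasurable (by fun_prop)]
    obtain ⟨u, hu, hu2⟩ := hval v (hmem v)
    have h1 : u = A v + v := hinj (by rw [hu2, hRA])
    have h2 := hu.sub (C.isValue_one v)
    rw [h1, add_sub_cancel_right] at h2
    exact h2.inner_eq

end SpectralTheorem

/-! ### Moments of the spectral measure as norms of iterates. -/

section Moments

open Filter Topology
open scoped ENNReal

variable {H : Type*} [NormedAddCommGroup H] [InnerProductSpace ℂ H]

/-- Polarization with u + v and u + iv, then density. It is needed because `IsSpectralMeasureOf`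
records only the quadratic form of `A`. -/
theorem eq_zero_of_inner_self_eq_zero {K : Submodule ℂ H} (hK : Dense (K : Set H))
    (D : K →ₗ[ℂ] H) (h : ∀ x : K, inner ℂ (x : H) (D x) = 0) : D = 0 := by
  have key : ∀ u v : K, inner ℂ (u : H) (D v) = 0 := by
    intro u v
    have h1 := h (u + v)
    have h2 := h (u + Complex.I • v)
    simp only [map_add, map_smul, Submodule.coe_add, Submodule.coe_smul, inner_add_left,
      inner_add_right, inner_smul_left, inner_smul_right, h, Complex.conj_I] at h1 h2
    have h3 : Complex.I * (inner ℂ (u : H) (D v) - inner ℂ (v : H) (D u)) = 0 := by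
      linear_combination h2
    have h4 := (mul_eq_zero.1 h3).resolve_left Complex.I_ne_zero
    linear_combination (h1 + h4) / 2
  ext v
  exact hK.eq_zero_of_inner_right (𝕜 := ℂ) fun u hu => key ⟨u, hu⟩ v

variable [CompleteSpace H] {A : H →ₗ.[ℂ] H} {E : ProjectionValuedMeasure H}

namespace ProjectionValuedMeasure

theorem IsSpectralMeasureOf.mem_domain_iff (hE : E.IsSpectralMeasureOf A) (v : H) :
    v ∈ A.domain ↔ MemLp (fun t : ℝ => t) 2 (E.scalarMeasure v) := by
  rw [hE.1, memLp_two_iff_lintegral _ measurable_id']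

/-- The values of λ define a linear operator on the domain of `A` with the same quadratic form as
`A`, hence equal to it. -/
theorem IsSpectralMeasureOf.isValue_apply (hE : E.IsSpectralMeasureOf A) (hA : IsSelfAdjoint A)
    (x : A.domain) : E.calculus.IsValue x (fun t => t) (A x) := by
  have hm : ∀ x : A.domain, MemLp (fun t : ℝ => t) 2 (E.calculus.meas x) :=
    fun x => (hE.mem_domain_iff x).1 x.2
  choose B hB using fun x : A.domain => E.calculus.exists_isValue (x : H) (hm x)
  let D : A.domain →ₗ[ℂ] H := A.toFun -
    { toFun := B
      map_add' := fun x y => (hB (x + y)).unique ((hB x).add_vector (hB y) (hm (x + y)))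
      map_smul' := fun c x => (hB (c • x)).unique ((hB x).smul_vector c (hm (c • x))) }
  have hD : D = 0 := eq_zero_of_inner_self_eq_zero hA.dense_domain D fun x => by
    change inner ℂ (x : H) (A x - B x) = 0
    rw [inner_sub_right, hE.2 x, (hB x).inner_eq]
    exact sub_self _
  have h : A x - B x = 0 := congrArg (· x) hD
  rw [sub_eq_zero.1 h]
  exact hB x

theorem IsSpectralMeasureOf.scalarMeasure_apply_eq (hE : E.IsSpectralMeasureOf A)
    (hA : IsSelfAdjoint A) (x : A.domain) :
    E.scalarMeasure (A x) = (E.scalarMeasure x).withDensity fun t => ‖t‖ₑ ^ 2 :=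
  (hE.isValue_apply hA x).meas_eq measurable_id'

theorem enorm_sq_eq (v : H) : ‖v‖ₑ ^ 2 = E.scalarMeasure v Set.univ := by
  rw [(E.calculus.isValue_one v).enorm, eLpNorm_two_sq_eq_lintegral]
  simp [calculus]

theorem IsSpectralMeasureOf.scalarMeasure_iterate (hE : E.IsSpectralMeasureOf A)
    (hA : IsSelfAdjoint A) {x : ℕ → H} (n : ℕ) (hx : ∀ k < n, (x k, x (k + 1)) ∈ A.graph) :
    E.scalarMeasure (x n) = (E.scalarMeasure (x 0)).withDensity fun t => ‖t‖ₑ ^ (2 * n) := by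
  induction n with
  | zero => simp
  | succ n ih =>
    obtain ⟨y, hy1, hy2⟩ := (LinearPMap.mem_graph_iff A).1 (hx n n.lt_succ_self)
    simp only at hy1 hy2
    rw [← hy2, hE.scalarMeasure_apply_eq hA, hy1, ih fun k hk => hx k (hk.trans n.lt_succ_self),
      ← withDensity_mul _ (by fun_prop) (by fun_prop)]
    congr 1
    ext t
    simp only [Pi.mul_apply]
    ring

/-- `∫ λ^{2n} d⟨v, E v⟩ = ‖A^n v‖²` -/
theorem IsSpectralMeasureOf.lintegral_pow (hE : E.IsSpectralMeasureOf A)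
    (hA : IsSelfAdjoint A) {x : ℕ → H} (n : ℕ) (hx : ∀ k < n, (x k, x (k + 1)) ∈ A.graph) :
    ∫⁻ t, ‖t‖ₑ ^ (2 * n) ∂(E.scalarMeasure (x 0)) = ‖x n‖ₑ ^ 2 := by
  rw [enorm_sq_eq (E := E), hE.scalarMeasure_iterate hA n hx, withDensity_apply _ .univ,
    Measure.restrict_univ]

theorem IsSpectralMeasureOf.mem_domain_of_lintegral_pow (hE : E.IsSpectralMeasureOf A)
    (hA : IsSelfAdjoint A) {x : ℕ → H} (n : ℕ) (hx : ∀ k < n, (x k, x (k + 1)) ∈ A.graph)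
    (h : ∫⁻ t, ‖t‖ₑ ^ (2 * (n + 1)) ∂(E.scalarMeasure (x 0)) < ⊤) : x n ∈ A.domain := by
  rw [hE.1, hE.scalarMeasure_iterate hA n hx,
    lintegral_withDensity_eq_lintegral_mul _ (by fun_prop) (by fun_prop)]
  refine lt_of_le_of_lt (lintegral_mono fun t => le_of_eq ?_) h
  simp only [Pi.mul_apply, ← enorm_sq_eq_ofReal]
  ring

/-- The spectral measure of a non-negative operator is concentrated on `[0, ∞)`. -/
theorem IsSpectralMeasureOf.ae_nonneg (hE : E.IsSpectralMeasureOf A)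
    (hpos : ∀ x : A.domain, 0 ≤ (inner ℂ (x : H) (A x)).re) (v : H) :
    ∀ᵐ t ∂(E.scalarMeasure v), 0 ≤ t := by
  -- The projection w of `v` onto the bounded set S = [-n, 0) lies in the domain, and ⟨w, Aw⟩ is the
  -- integral of t over S. It is non-negative although t < 0 on S, so S is null.
  have key : ∀ n : ℕ, E.scalarMeasure v (Set.Ico (-n : ℝ) 0) = 0 := by
    intro n
    set S := Set.Ico (-n : ℝ) 0
    have hS : MeasurableSet S := measurableSet_Ico
    have h1 : E.scalarMeasure (E.calculus.proj S v) = (E.scalarMeasure v).restrict S := by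
      have h := (E.calculus.isValue_proj hS v).meas_eq (measurable_one.indicator hS)
      have h2 : (fun t => ‖S.indicator (1 : ℝ → ℝ) t‖ₑ ^ 2) = S.indicator 1 := by
        ext t
        by_cases ht : t ∈ S <;> simp [ht]
      rw [h2, withDensity_indicator_one hS] at h
      exact h
    have hb : ∀ᵐ t ∂((E.scalarMeasure v).restrict S), ‖t‖ ≤ n := by
      filter_upwards [ae_restrict_mem hS] with t ht
      rw [Real.norm_eq_abs, abs_le]
      exact ⟨ht.1, ht.2.le.trans n.cast_nonneg⟩
    have hmem : MemLp (fun t : ℝ => t) 2 ((E.scalarMeasure v).restrict S) :=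
      .of_bound measurable_id'.aestronglyMeasurable n hb
    have hdom : E.calculus.proj S v ∈ A.domain := by
      rwa [hE.mem_domain_iff, h1]
    have h2 := hpos ⟨_, hdom⟩
    rw [hE.2 ⟨_, hdom⟩, Complex.ofReal_re, h1] at h2
    have hneg : 0 ≤ᵐ[(E.scalarMeasure v).restrict S] fun t => -t := by
      filter_upwards [ae_restrict_mem hS] with t ht
      simpa using ht.2.le
    have h3 : ∫ t in S, -t ∂(E.scalarMeasure v) = 0 := by
      refine le_antisymm ?_ (integral_nonneg_of_ae hneg)
      rw [integral_neg]
      linarith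
    rw [integral_eq_zero_iff_of_nonneg_ae hneg (hmem.integrable (by norm_num)).neg] at h3
    rw [← Measure.restrict_eq_zero, ← ae_eq_bot, ← Filter.empty_mem_iff_bot]
    filter_upwards [h3, ae_restrict_mem hS] with t ht ht2
    simp only [Pi.zero_apply, neg_eq_zero] at ht
    exact absurd ht ht2.2.ne
  rw [ae_iff]
  refine measure_mono_null (fun t ht => ?_) (measure_iUnion_null key)
  obtain ⟨n, hn⟩ := exists_nat_ge (-t)
  exact Set.mem_iUnion.2 ⟨n, by linarith, not_le.1 ht⟩

end ProjectionValuedMeasure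

end Moments

/-! ### Exponential integrability against factorial growth of the iterates. -/

section Estimates

open scoped ENNReal

theorem pow_le_mul_exp_sq {s D t : ℝ} (hs : 0 < s) (hD : 0 < D) (ht : 0 ≤ t) (m : ℕ) :
    t ^ m ≤ (((s / D) ^ s) ^ m * (m.factorial : ℝ) ^ s) ^ 2 *
      Real.exp (D * t ^ (1 / (2 * s))) ^ 2 := by
  set x := t ^ (1 / (2 * s)) with hx
  have hx0 : 0 ≤ x := Real.rpow_nonneg ht _
  -- Chosen so that (e^y)^(2s) = exp(D x)², when y^m ≤ m! e^y is raised to the power 2s.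
  set y := D * x / s with hy
  have hy0 : 0 ≤ y := by positivity
  have hty : t = ((s / D) ^ s) ^ 2 * y ^ (2 * s) := by
    have h1 : ((s / D) ^ s) ^ 2 = (s / D) ^ (2 * s) := by
      rw [← Real.rpow_mul_natCast (by positivity)]
      congr 1; push_cast; ring
    rw [h1, ← Real.mul_rpow (by positivity) hy0]
    have h2 : s / D * y = x := by rw [hy]; field_simp
    rw [h2, hx, ← Real.rpow_mul ht, one_div_mul_cancel (by positivity), Real.rpow_one]
  have h1 : y ^ m ≤ m.factorial * Real.exp y := by
    have := Real.pow_div_factorial_le_exp y hy0 m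
    rwa [div_le_iff₀' (by positivity)] at this
  have h2 : (y ^ (2 * s)) ^ m ≤ ((m.factorial : ℝ) ^ s) ^ 2 * Real.exp (D * x) ^ 2 := by
    calc (y ^ (2 * s)) ^ m = (y ^ m) ^ (2 * s) := by
          rw [← Real.rpow_mul_natCast hy0, mul_comm, Real.rpow_natCast_mul hy0]
      _ ≤ (m.factorial * Real.exp y) ^ (2 * s) :=
          Real.rpow_le_rpow (by positivity) h1 (by positivity)
      _ = _ := by
        rw [Real.mul_rpow (by positivity) (by positivity), ← Real.exp_mul,
          ← Real.rpow_mul_natCast (by positivity), ← Real.exp_nat_mul]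
        congr 2
        · push_cast; ring
        · rw [hy]; push_cast; field_simp
  calc t ^ m = (((s / D) ^ s) ^ m) ^ 2 * (y ^ (2 * s)) ^ m := by
        conv_lhs => rw [hty]
        ring
    _ ≤ (((s / D) ^ s) ^ m) ^ 2 * (((m.factorial : ℝ) ^ s) ^ 2 * Real.exp (D * x) ^ 2) := by
        gcongr
    _ = _ := by ring

/-- With y = (t/(eB))^(1/(2s)), take for m = 2k the largest even integer not exceeding y. Then
(m!)^(2s) ≤ m^(2sm) ≤ (t/(eB))^m, so t^m / (B^m (m!)^(2s)) ≥ e^m, and y < m + 2 accounts for the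
factor e². -/
theorem exists_exp_le_mul_pow {s B t : ℝ} (hs : 0 < s) (hB : 0 < B) (ht : 0 ≤ t) :
    ∃ k : ℕ, Real.exp ((Real.exp 1 * B) ^ (-(1 / (2 * s))) * t ^ (1 / (2 * s))) ≤
      Real.exp 2 / (B ^ (2 * k) * (((2 * k).factorial : ℝ) ^ s) ^ 2) * t ^ (2 * k) := by
  set e := Real.exp 1
  have he : 0 < e := Real.exp_pos 1
  set y := (e * B) ^ (-(1 / (2 * s))) * t ^ (1 / (2 * s)) with hy
  have hy0 : 0 ≤ y := by positivity
  have hyt : y ^ (2 * s) * (e * B) = t := by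
    rw [hy, Real.mul_rpow (by positivity) (by positivity), ← Real.rpow_mul (by positivity),
      ← Real.rpow_mul ht, one_div_mul_cancel (by positivity), Real.rpow_one, neg_mul,
      one_div_mul_cancel (by positivity), Real.rpow_neg_one]
    field_simp
  refine ⟨⌊y / 2⌋₊, ?_⟩
  set k := ⌊y / 2⌋₊
  have hk1 : ((2 * k : ℕ) : ℝ) ≤ y := by
    have := Nat.floor_le (a := y / 2) (by positivity)
    push_cast; linarith
  have hk2 : y < ((2 * k : ℕ) : ℝ) + 2 := by
    have := Nat.lt_floor_add_one (y / 2)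
    push_cast; linarith
  set m := 2 * k
  have h1 : (m : ℝ) ^ (2 * s) * (e * B) ≤ t := by
    rw [← hyt]
    gcongr
  have h2 : ((m.factorial : ℝ) ^ s) ^ 2 ≤ ((m : ℝ) ^ (2 * s)) ^ m := by
    have h3 : (m.factorial : ℝ) ≤ (m : ℝ) ^ m := by exact_mod_cast m.factorial_le_pow
    calc ((m.factorial : ℝ) ^ s) ^ 2 = (m.factorial : ℝ) ^ (2 * s) := by
          rw [← Real.rpow_mul_natCast (by positivity)]
          congr 1; push_cast; ring
      _ ≤ ((m : ℝ) ^ m) ^ (2 * s) := Real.rpow_le_rpow (by positivity) h3 (by positivity)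
      _ = _ := by
        rw [← Real.rpow_mul_natCast (by positivity), mul_comm (2 * s),
          Real.rpow_natCast_mul (by positivity)]
  have h4 : ((m.factorial : ℝ) ^ s) ^ 2 * (e ^ m * B ^ m) ≤ t ^ m := by
    calc _ ≤ ((m : ℝ) ^ (2 * s)) ^ m * (e ^ m * B ^ m) := by gcongr
      _ = ((m : ℝ) ^ (2 * s) * (e * B)) ^ m := by ring
      _ ≤ t ^ m := by gcongr
  have h5 : Real.exp y ≤ Real.exp 2 * e ^ m := by
    rw [← Real.exp_nat_mul, ← Real.exp_add]
    exact Real.exp_le_exp.2 (by linarith)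
  rw [div_mul_eq_mul_div, le_div_iff₀ (by positivity)]
  calc Real.exp y * (B ^ m * ((m.factorial : ℝ) ^ s) ^ 2)
      ≤ Real.exp 2 * e ^ m * (B ^ m * ((m.factorial : ℝ) ^ s) ^ 2) := by gcongr
    _ = Real.exp 2 * (((m.factorial : ℝ) ^ s) ^ 2 * (e ^ m * B ^ m)) := by ring
    _ ≤ Real.exp 2 * t ^ m := by gcongr

variable {H : Type*} [NormedAddCommGroup H] [InnerProductSpace ℂ H] [CompleteSpace H]
  {A : H →ₗ.[ℂ] H}

theorem IsSelfAdjoint.mem_functionalCalculusDomain_of_iterate_le (hA : IsSelfAdjoint A)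
    (hpos : ∀ x : A.domain, 0 ≤ (inner ℂ (x : H) (A x)).re) {s a c : ℝ} (hs : 0 < s)
    (ha : 0 < a) {x : ℕ → H} (hx : ∀ k, (x k, x (k + 1)) ∈ A.graph)
    (hle : ∀ k : ℕ, ‖x k‖ ≤ c * a ^ (2 * k) * ((2 * k).factorial : ℝ) ^ s) :
    ∃ D : ℝ, 0 < D ∧ x 0 ∈ functionalCalculusDomain A
      (fun t => Real.exp (D * t ^ (1 / (2 * s)))) := by
  obtain ⟨E, hE⟩ := hA.exists_isSpectralMeasureOf hpos
  -- The factor 2 leaves the ratio (a²/B)² = 1/4 in the final series.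
  set B := 2 * a ^ 2
  have hB : 0 < B := by positivity
  set d := (Real.exp 1 * B) ^ (-(1 / (2 * s)))
  have hd : 0 < d := by positivity
  -- Half of `d`, because the exponential is squared in the integral.
  refine ⟨d / 2, by positivity, E, hE, ?_⟩
  set w : ℕ → ℝ := fun k => Real.exp 2 / (B ^ (2 * k) * (((2 * k).factorial : ℝ) ^ s) ^ 2)
  have hw : ∀ k, 0 ≤ w k := fun k => by positivity
  have hbound : ∀ᵐ t ∂(E.scalarMeasure (x 0)),
      ENNReal.ofReal (|Real.exp (d / 2 * t ^ (1 / (2 * s)))| ^ 2) ≤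
        ∑' k, ENNReal.ofReal (w k) * ‖t‖ₑ ^ (2 * k) := by
    filter_upwards [hE.ae_nonneg hpos (x 0)] with t ht
    obtain ⟨k, hk⟩ := exists_exp_le_mul_pow hs hB ht
    refine le_trans ?_ (ENNReal.le_tsum k)
    rw [Real.enorm_of_nonneg ht, ← ENNReal.ofReal_pow ht, ← ENNReal.ofReal_mul (hw k)]
    refine ENNReal.ofReal_le_ofReal (le_of_eq_of_le ?_ hk)
    rw [sq_abs, ← Real.exp_nat_mul]
    congr 1; push_cast; ring
  refine lt_of_le_of_lt (lintegral_mono_ae hbound) ?_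
  rw [lintegral_tsum fun k => by fun_prop]
  have hterm : ∀ k, ∫⁻ t, ENNReal.ofReal (w k) * ‖t‖ₑ ^ (2 * k) ∂(E.scalarMeasure (x 0)) ≤
      ENNReal.ofReal (Real.exp 2 * c ^ 2 * (1 / 4) ^ k) := by
    intro k
    rw [lintegral_const_mul _ (by fun_prop), hE.lintegral_pow hA k fun j _ => hx j,
      ← ofReal_norm, ← ENNReal.ofReal_pow (norm_nonneg _), ← ENNReal.ofReal_mul (hw k)]
    refine ENNReal.ofReal_le_ofReal ?_
    calc w k * ‖x k‖ ^ 2 ≤ w k * (c * a ^ (2 * k) * ((2 * k).factorial : ℝ) ^ s) ^ 2 := by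
          gcongr
          exact hle k
      _ = Real.exp 2 * c ^ 2 * (1 / 4) ^ k := by
          have h4 : B ^ (2 * k) = (a ^ (2 * k)) ^ 2 * 4 ^ k := by
            simp only [B, mul_pow, pow_mul]; norm_num; ring
          simp only [w, h4, one_div_pow]
          field_simp
  refine lt_of_le_of_lt (ENNReal.tsum_le_tsum hterm) ?_
  have hsum : Summable fun k : ℕ => Real.exp 2 * c ^ 2 * (1 / 4 : ℝ) ^ k :=
    (summable_geometric_of_lt_one (by norm_num) (by norm_num)).mul_left _
  rw [← ENNReal.ofReal_tsum_of_nonneg (fun k => by positivity) hsum]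
  exact ENNReal.ofReal_lt_top

theorem IsSelfAdjoint.exists_iterate_le_of_mem_functionalCalculusDomain (hA : IsSelfAdjoint A)
    (hpos : ∀ x : A.domain, 0 ≤ (inner ℂ (x : H) (A x)).re) {s D : ℝ} (hs : 0 < s)
    (hD : 0 < D) {v : H} (hv : v ∈ functionalCalculusDomain A
      (fun t => Real.exp (D * t ^ (1 / (2 * s))))) :
    ∃ x : ℕ → H, x 0 = v ∧ (∀ k, (x k, x (k + 1)) ∈ A.graph) ∧
      ∃ a c : ℝ, 0 < a ∧ 0 < c ∧
        ∀ k : ℕ, ‖x k‖ ≤ c * a ^ (2 * k) * ((2 * k).factorial : ℝ) ^ s := by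
  classical
  obtain ⟨E, hE, hint⟩ := hv
  set I := ∫⁻ t, ENNReal.ofReal (|Real.exp (D * t ^ (1 / (2 * s)))| ^ 2) ∂(E.scalarMeasure v)
  set a := (s / D) ^ s
  have ha : 0 < a := by positivity
  set M : ℕ → ℝ := fun k => (a ^ (2 * k) * ((2 * k).factorial : ℝ) ^ s) ^ 2
  have hM : ∀ k, 0 ≤ M k := fun k => by positivity
  have hmom : ∀ k, ∫⁻ t, ‖t‖ₑ ^ (2 * k) ∂(E.scalarMeasure v) ≤ ENNReal.ofReal (M k) * I := by
    intro k
    rw [← lintegral_const_mul' _ _ ENNReal.ofReal_ne_top]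
    refine lintegral_mono_ae ?_
    filter_upwards [hE.ae_nonneg hpos v] with t ht
    rw [Real.enorm_of_nonneg ht, ← ENNReal.ofReal_pow ht, ← ENNReal.ofReal_mul (hM k), sq_abs]
    exact ENNReal.ofReal_le_ofReal (pow_le_mul_exp_sq hs hD ht (2 * k))
  -- The default 0 outside the domain is never reached: finiteness of the moment of order 2(k + 1)
  -- puts `x k` in the domain, once all earlier iterates are known to be there.
  let x : ℕ → H := fun k => k.rec v fun _ y => if h : y ∈ A.domain then A ⟨y, h⟩ else 0
  have hstep : ∀ k, x k ∈ A.domain → (x k, x (k + 1)) ∈ A.graph := by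
    intro k hk
    have : x (k + 1) = A ⟨x k, hk⟩ := dif_pos hk
    rw [this]
    exact A.mem_graph ⟨x k, hk⟩
  have hdom : ∀ k, x k ∈ A.domain := by
    intro k
    induction k using Nat.strong_induction_on with
    | _ k ih =>
      exact hE.mem_domain_of_lintegral_pow hA k (fun j hj => hstep j (ih j hj))
        ((hmom (k + 1)).trans_lt (ENNReal.mul_lt_top ENNReal.ofReal_lt_top hint))
  have hx := fun k => hstep k (hdom k)
  -- The added 1 keeps the constant positive when the integral vanishes.
  refine ⟨x, rfl, hx, a, √I.toReal + 1, ha, by positivity, fun k => ?_⟩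
  have h1 := (hE.lintegral_pow hA k fun j _ => hx j).symm.trans_le (hmom k)
  rw [← ofReal_norm, ← ENNReal.ofReal_pow (norm_nonneg _), ← ENNReal.ofReal_toReal hint.ne,
    ← ENNReal.ofReal_mul (hM k), ENNReal.ofReal_le_ofReal_iff (by positivity)] at h1
  have h2 : ‖x k‖ ≤ √(M k * I.toReal) := Real.le_sqrt_of_sq_le h1
  rw [Real.sqrt_mul (hM k), Real.sqrt_sq (by positivity)] at h2
  have h3 : 0 ≤ a ^ (2 * k) * ((2 * k).factorial : ℝ) ^ s := by positivity
  linarith [mul_comm (√I.toReal) (a ^ (2 * k) * ((2 * k).factorial : ℝ) ^ s)]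

end Estimates

/-! ### The closure acts on smooth functions as the differential operator. -/

section Manifold

open Filter Topology

variable {n : ℕ} {M : Type*} [TopologicalSpace M] [ChartedSpace (EuclideanSpace ℝ (Fin n)) M]
  {r : ℕ} {X : Fin r → (x : M) → TangentSpace (𝓡 n) x}

theorem applyField_congr {V : (x : M) → TangentSpace (𝓡 n) x} {f g : M → ℂ} {x : M}
    (h : f =ᶠ[𝓝 x] g) : applyField V f =ᶠ[𝓝 x] applyField V g := by
  filter_upwards [h.eventuallyEq_nhds] with y hy
  simp only [applyField]
  rw [hy.mfderiv_eq]
  rfl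

theorem subLaplacian_congr {f g : M → ℂ} {x : M} (h : f =ᶠ[𝓝 x] g) :
    subLaplacian X f x = subLaplacian X g x := by
  simp only [subLaplacian]
  congr 1
  exact Finset.sum_congr rfl fun j _ => (applyField_congr (applyField_congr h)).eq_of_nhds

theorem subLaplacian_zero : subLaplacian X (0 : M → ℂ) = 0 := by
  have h : ∀ V : (x : M) → TangentSpace (𝓡 n) x, applyField V (0 : M → ℂ) = 0 := fun V => by
    funext x
    have : mfderiv (𝓡 n) 𝓘(ℝ, ℂ) (0 : M → ℂ) x = 0 := mfderiv_const
    simp only [applyField, this]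
    rfl
  funext x
  simp [subLaplacian, h]

theorem tsupport_subLaplacian_subset (f : M → ℂ) : tsupport (subLaplacian X f) ⊆ tsupport f := by
  refine closure_minimal (fun x hx => ?_) (isClosed_tsupport f)
  by_contra h
  refine hx ?_
  rw [subLaplacian_congr (notMem_tsupport_iff_eventuallyEq.1 h), subLaplacian_zero]
  rfl

variable [IsManifold (𝓡 n) ∞ M]

theorem contMDiff_subLaplacian (hX : IsHormanderSystem X) {f : M → ℂ}
    (hf : ContMDiff (𝓡 n) 𝓘(ℝ, ℂ) ∞ f) : ContMDiff (𝓡 n) 𝓘(ℝ, ℂ) ∞ (subLaplacian X f) := by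
  have : subLaplacian X f = -∑ j, applyField (X j) (applyField (X j) f) := by
    funext x; simp [subLaplacian]
  rw [this]
  have h : ∀ j, ContMDiff (𝓡 n) 𝓘(ℝ, ℂ) ∞ (applyField (X j) (applyField (X j) f)) := fun j =>
    contMDiff_applyField (hX.smooth j) (contMDiff_applyField (hX.smooth j) hf)
  exact (contMDiff_finsetSum' (t := Finset.univ) fun j _ => h j).neg

theorem contMDiff_iterate_subLaplacian (hX : IsHormanderSystem X) {f : M → ℂ}
    (hf : ContMDiff (𝓡 n) 𝓘(ℝ, ℂ) ∞ f) (k : ℕ) :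
    ContMDiff (𝓡 n) 𝓘(ℝ, ℂ) ∞ ((subLaplacian X)^[k] f) := by
  induction k with
  | zero => exact hf
  | succ k ih => rw [Function.iterate_succ_apply']; exact contMDiff_subLaplacian hX ih

variable [T2Space M] [SecondCountableTopology M] [MeasurableSpace M] [BorelSpace M]
  {μ : Measure M} [IsLocallyFiniteMeasure μ]

/-- For a test function u, ⟨u, g⟩ = ⟨Lu, f⟩ = ⟨Lu, χf⟩ = ⟨u, L(χf)⟩ = ⟨u, Lf⟩, where χ is a cutoff
equal to 1 near the support of u. The cutoff is needed because Lf is not known to be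
square-integrable. Symmetry of the self-adjoint closure replaces integration by parts with respect
to μ. -/
theorem ae_eq_subLaplacian_of_mem_graph (hX : IsHormanderSystem X)
    (hsa : IsEssentiallySelfAdjoint (subLaplacianGraph μ hX)) {f : M → ℂ}
    (hf : ContMDiff (𝓡 n) 𝓘(ℝ, ℂ) ∞ f) (hf2 : MemLp f 2 μ) {g : Lp ℂ 2 μ}
    (hg : (hf2.toLp f, g) ∈ (operatorClosure (subLaplacianGraph μ hX)).graph) :
    g =ᵐ[μ] subLaplacian X f := by
  have : LocallyCompactSpace M := ChartedSpace.locallyCompactSpace (EuclideanSpace ℝ (Fin n)) M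
  obtain ⟨hA, hgr⟩ := hsa.closure_spec
  have hLf := contMDiff_subLaplacian hX hf
  have hsymm : ∀ p ∈ (operatorClosure (subLaplacianGraph μ hX)).graph,
      ∀ q ∈ (operatorClosure (subLaplacianGraph μ hX)).graph,
      inner ℂ p.2 q.1 = inner ℂ p.1 q.2 := by
    intro p hp q hq
    obtain ⟨x, hx1, hx2⟩ := (LinearPMap.mem_graph_iff _).1 hp
    obtain ⟨y, hy1, hy2⟩ := (LinearPMap.mem_graph_iff _).1 hq
    rw [← hx1, ← hx2, ← hy1, ← hy2]
    exact hA.inner_linearPMap x y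
  have hmem : ∀ u : M → ℂ, ContMDiff (𝓡 n) 𝓘(ℝ, ℂ) ∞ u → ∀ hu2 : MemLp u 2 μ,
      ∀ hLu : MemLp (subLaplacian X u) 2 μ,
      (hu2.toLp u, hLu.toLp _) ∈ (operatorClosure (subLaplacianGraph μ hX)).graph := by
    intro u hu hu2 hLu
    rw [hgr]
    exact Submodule.le_topologicalClosure _ ⟨u, hu, hu2, hLu, rfl⟩
  have hcs : ∀ u : M → ℂ, ContMDiff (𝓡 n) 𝓘(ℝ, ℂ) ∞ u → HasCompactSupport u →
      MemLp u 2 μ ∧ MemLp (subLaplacian X u) 2 μ := by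
    intro u hu huc
    refine ⟨hu.continuous.memLp_of_hasCompactSupport huc,
      (contMDiff_subLaplacian hX hu).continuous.memLp_of_hasCompactSupport ?_⟩
    exact huc.of_isClosed_subset (isClosed_tsupport _) (tsupport_subLaplacian_subset u)
  have h1 : LocallyIntegrable g μ := (Lp.memLp g).locallyIntegrable (by norm_num)
  have h2 : LocallyIntegrable (subLaplacian X f) μ := hLf.continuous.locallyIntegrable
  have key : ∀ h : M → ℝ, ContMDiff (𝓡 n) 𝓘(ℝ) ∞ h → HasCompactSupport h →
      ∫ x, h x • (g - subLaplacian X f) x ∂μ = 0 := by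
    intro h hh hhc
    let u : M → ℂ := fun x => (h x : ℂ)
    have hu : ContMDiff (𝓡 n) 𝓘(ℝ, ℂ) ∞ u := Complex.ofRealCLM.contMDiff.comp hh
    have huc : HasCompactSupport u := hhc.comp_left (g := Complex.ofReal) rfl
    obtain ⟨hu2, hLu⟩ := hcs u hu huc
    obtain ⟨K, hK, hKu⟩ := exists_compact_superset huc
    obtain ⟨χ, hχ1, hχ0, -⟩ := exists_contMDiffMap_one_nhds_of_subset_interior (n := (⊤ : ℕ∞)) (𝓡 n)
      (isClosed_tsupport u) hKu
    let w : M → ℂ := fun x => χ x • f x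
    have hw : ContMDiff (𝓡 n) 𝓘(ℝ, ℂ) ∞ w := χ.contMDiff.smul hf
    have hwc : HasCompactSupport w := HasCompactSupport.intro hK fun x hx => by
      simp [w, hχ0 x hx]
    obtain ⟨hw2, hLw⟩ := hcs w hw hwc
    have hwf : ∀ x ∈ tsupport u, w =ᶠ[𝓝 x] f := fun x hx => by
      filter_upwards [hχ1.filter_mono (nhds_le_nhdsSet hx)] with y hy
      simp [w, hy]
    have hu' : ∀ x, ∀ z : ℂ, inner ℂ (u x) z = h x • z := fun x z => by
      simp [u, Complex.real_smul, mul_comm]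
    have h3 : ∫ x, h x • g x ∂μ = ∫ x, h x • subLaplacian X f x ∂μ := by
      calc ∫ x, h x • g x ∂μ = inner ℂ (hu2.toLp u) g := by
            rw [L2.inner_def]
            refine integral_congr_ae ?_
            filter_upwards [hu2.coeFn_toLp] with x hx
            rw [hx, hu']
        _ = inner ℂ (hLu.toLp (subLaplacian X u)) (hf2.toLp f) :=
            (hsymm _ (hmem u hu hu2 hLu) _ hg).symm
        _ = inner ℂ (hLu.toLp (subLaplacian X u)) (hw2.toLp w) := by
            rw [L2.inner_def, L2.inner_def]
            refine integral_congr_ae ?_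
            filter_upwards [hf2.coeFn_toLp, hw2.coeFn_toLp, hLu.coeFn_toLp] with x hx1 hx2 hx3
            rw [hx1, hx2, hx3]
            by_cases hx : x ∈ tsupport u
            · rw [(hwf x hx).eq_of_nhds]
            · rw [image_eq_zero_of_notMem_tsupport
                (fun h => hx (tsupport_subLaplacian_subset (X := X) u h))]
              simp
        _ = inner ℂ (hu2.toLp u) (hLw.toLp (subLaplacian X w)) :=
            hsymm _ (hmem u hu hu2 hLu) _ (hmem w hw hw2 hLw)
        _ = ∫ x, h x • subLaplacian X f x ∂μ := by
            rw [L2.inner_def]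
            refine integral_congr_ae ?_
            filter_upwards [hLw.coeFn_toLp, hu2.coeFn_toLp] with x hx1 hx2
            rw [hx1, hx2, hu']
            by_cases hx : x ∈ tsupport u
            · rw [subLaplacian_congr (hwf x hx)]
            · have : h x = 0 := by
                simpa [u] using image_eq_zero_of_notMem_tsupport hx
              simp [this]
    simp only [Pi.sub_apply, smul_sub]
    rw [integral_sub (h1.integrable_smul_left_of_hasCompactSupport hh.continuous hhc)
      (h2.integrable_smul_left_of_hasCompactSupport hh.continuous hhc), h3, sub_self]
  have h0 := ae_eq_zero_of_integral_contMDiff_smul_eq_zero (𝓡 n) (h1.sub h2) key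
  filter_upwards [h0] with x hx
  exact sub_eq_zero.1 hx

end Manifold
-- The equivalence.
theorem proposition4p3 {n : ℕ} {M : Type*} [TopologicalSpace M] [T2Space M]
    [SecondCountableTopology M] [ChartedSpace (EuclideanSpace ℝ (Fin n)) M]
    [IsManifold (𝓡 n) ∞ M] [MeasurableSpace M] [BorelSpace M]
    (μ : Measure M) [IsLocallyFiniteMeasure μ]
    {r : ℕ} (X : Fin r → (x : M) → TangentSpace (𝓡 n) x) (hX : IsHormanderSystem X)
    (hsa : IsEssentiallySelfAdjoint (subLaplacianGraph μ hX))
    (hnonneg : IsNonnegativeOperator (subLaplacianGraph μ hX))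
    (s : ℝ) (hs : 0 < s) (φ : M → ℂ) (hφ : ContMDiff (𝓡 n) 𝓘(ℝ, ℂ) ∞ φ) :
    (∃ A C : ℝ, 0 < A ∧ 0 < C ∧ ∀ k : ℕ,
      eLpNorm ((subLaplacian X)^[k] φ) 2 μ ≤
        ENNReal.ofReal (C * A ^ (2 * k) * ((Nat.factorial (2 * k) : ℕ) : ℝ) ^ s)) ↔
    (∃ D : ℝ, 0 < D ∧ ∃ hφ2 : MemLp φ 2 μ,
      hφ2.toLp φ ∈ functionalCalculusDomain (operatorClosure (subLaplacianGraph μ hX))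
        (fun t => Real.exp (D * t ^ (1 / (2 * s))))) := by
  obtain ⟨hA, hgr⟩ := hsa.closure_spec
  set T := operatorClosure (subLaplacianGraph μ hX) with hT
  -- Non-negativity is a closed condition on pairs, so it passes from the graph to its closure.
  have hpos : ∀ x : T.domain, 0 ≤ (inner ℂ (x : Lp ℂ 2 μ) (T x)).re := by
    intro x
    have h1 : ((x : Lp ℂ 2 μ), T x) ∈ closure (subLaplacianGraph μ hX : Set _) := by
      have := T.mem_graph x
      rwa [hgr] at this
    have h2 : IsClosed {p : Lp ℂ 2 μ × Lp ℂ 2 μ | 0 ≤ (inner ℂ p.1 p.2).re} :=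
      isClosed_le continuous_const
        (Complex.continuous_re.comp (continuous_fst.inner continuous_snd))
    exact closure_minimal (fun p hp => (hnonneg p hp).1) h2 h1
  have hsmooth := contMDiff_iterate_subLaplacian hX hφ
  constructor
  · rintro ⟨a, c, ha, hc, hle⟩
    have hmem : ∀ k, MemLp ((subLaplacian X)^[k] φ) 2 μ := fun k =>
      ⟨(hsmooth k).continuous.aestronglyMeasurable, (hle k).trans_lt ENNReal.ofReal_lt_top⟩
    obtain ⟨D, hD, h⟩ := hA.mem_functionalCalculusDomain_of_iterate_le hpos hs ha (c := c)
      (x := fun k => (hmem k).toLp _) (fun k => by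
        rw [hgr]
        refine Submodule.le_topologicalClosure _ ⟨_, hsmooth k, hmem k, ?_, ?_⟩
        · rw [← Function.iterate_succ_apply' (subLaplacian X)]; exact hmem (k + 1)
        · simp only [Function.iterate_succ_apply']) (fun k => by
        rw [Lp.norm_toLp]
        exact ENNReal.toReal_le_of_le_ofReal (by positivity) (hle k))
    exact ⟨D, hD, hmem 0, h⟩
  · rintro ⟨D, hD, hφ2, h⟩
    obtain ⟨x, hx0, hx, a, c, ha, hc, hle⟩ :=
      hA.exists_iterate_le_of_mem_functionalCalculusDomain hpos hs hD h
    refine ⟨a, c, ha, hc, ?_⟩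
    -- Inductively, the abstract iterate is the class of the smooth function L^k φ, which is thereby
    -- shown to be square-integrable.
    have hcls : ∀ k, ∃ hk : MemLp ((subLaplacian X)^[k] φ) 2 μ, hk.toLp _ = x k := by
      intro k
      induction k with
      | zero => exact ⟨hφ2, hx0.symm⟩
      | succ k ih =>
        obtain ⟨hk, hk2⟩ := ih
        have hg := hx k
        rw [← hk2] at hg
        have h1 := ae_eq_subLaplacian_of_mem_graph hX hsa (hsmooth k) hk hg
        rw [Function.iterate_succ_apply']
        have h2 := (memLp_congr_ae h1).1 (Lp.memLp (x (k + 1)))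
        exact ⟨h2, Lp.ext (h2.coeFn_toLp.trans h1.symm)⟩
    intro k
    obtain ⟨hk, hk2⟩ := hcls k
    have h1 := hle k
    rw [← hk2, Lp.norm_toLp] at h1
    rw [← ENNReal.ofReal_toReal hk.eLpNorm_ne_top]
    exact ENNReal.ofReal_le_ofReal h1
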